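/- Let $\mathcal G_1$ be the figure-8 graph (one vertex, two loops $e_1,e_2$), let $\mathcal E^o=\{e_1,\bar e_1,e_2,\bar e_2\}$ be its directed edges, and for $l:\{e_1,e_2\}\to\mathbb R_{>0}$ let the entropy be $h(l)=\lim_{T\to\infty}\frac1T\log\#\{\gamma: l(\gamma)<T\}$, where $\gamma=(e_0,\dots,e_n=e_0)$, $n\ge1$, runs over the closed cycles of directed edges without backtracking and $l(\gamma)=\sum_{i<n}l(e_i)$. Put $\mathcal M^1=\{l>0: h(l)=1\}$. Let $\Sigma^+$ be the space of one-sided infinite paths of directed edges without backtracking and $\sigma$ the shift on it. Regard a function $\phi$ on the edges as the function $\phi(\underline e)=\phi(e_0)$ on $\Sigma^+$. For $l\in\mathcal M^1$ let $m_{-l}=v\mu/\int v\,d\mu$ be the equilibrium state of $-l$: here $(\mathcal L w)(\underline x)=\sum_{\sigma\underline y=\underline x}e^{-l(\underline y)}w(\underline y)$ is the transfer operator, $v$ is a strictly positive continuous function with $\mathcal Lv=v$, and $\mu$ is a probability measure with $\mathcal L^*\mu=\mu$. A function $\phi$ on the edges is tangent to $\mathcal M^1$ at $l$ if $\int\phi\,dm_{-l}=0$;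 its pressure norm is given by $$\|\phi\|_P^2=\mathrm{Var}(\phi,m_{-l})=\lim_{n\to\infty}\frac1n\int\Big(\sum_{i<n}\phi\circ\sigma^i-n\int\phi\,dm_{-l}\Big)^2dm_{-l}.$$ Let $d_P$ be the path distance on $\mathcal M^1$: the infimum of $\int_0^1\|\dot\gamma(t)\|_P\,dt$ over the $C^1$ curves $\gamma:[0,1]\to\mathcal M^1$ between two given points. Then: 1. For every $l\in\mathcal M^1$ the equilibrium state $m_{-l}$ exists and is unique, and the limit defining $\|\phi\|_P^2$ exists for every tangent $\phi$. 2. $\mathcal M^1=\{c(x):x>0\}$ for the smooth curve $c(x)=\Big(x,\,-\log\frac{1-e^{-x}}{1+3e^{-x}}\Big)$, where $x=l(e_1)$. 3. For every $x>0$ the vector $\dot c(x)$ is tangent to $\mathcal M^1$ at $c(x)$, and $$\|\dot c(x)\|_P^2=\frac{4e^x(e^{2x}+3)}{e^{4x}+8e^{3x}+6e^{2x}-24e^x+9}.$$ 4. $\|\dot c(x)\|_P^2\sim\frac1x$ as $x\to0^+$, and $\int_0^1\|\dot c(x)\|_P\,dx<\infty$, so the boundary point $x=0$ is reached at finite length.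 5. $d_P$ is a metric on $\mathcal M^1$, and the metric space $(\mathcal M^1,d_P)$ is not complete. -/

import Mathlib

open Filter Topology MeasureTheory Set
open scoped ENNReal ContDiff

noncomputable section

namespace MetricGraph

/-- A finite undirected multigraph (loops allowed) with vertices `V` and edges `e_0, …, e_{k-1}`.
The endpoints of every edge are listed in an arbitrary reference order. -/
structure UGraph (V : Type) (k : ℕ) where
  fst : Fin k → V
  snd : Fin k → V

/-- Directed edges: `(e, true)` is `e` run from `fst e` to `snd e`, and `(e, false)` is its
reverse. -/
abbrev DirEdge (k : ℕ) : Type := Fin k × Bool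

/-- The same edge with the opposite direction. -/
def DirEdge.bar {k : ℕ} (e : DirEdge k) : DirEdge k := (e.1, !e.2)

namespace UGraph

variable {V : Type} {k : ℕ} (G : UGraph V k)

/-- The initial vertex of a directed edge. -/
def origin (e : DirEdge k) : V := if e.2 then G.fst e.1 else G.snd e.1

/-- The terminal vertex of a directed edge. -/
def terminus (e : DirEdge k) : V := if e.2 then G.snd e.1 else G.fst e.1

/-- `A(e, e') = 1`: the edge `e'` follows `e` and is not the reverse of `e`. -/
def Adm (e e' : DirEdge k) : Prop := G.origin e' = G.terminus e ∧ e' ≠ e.bar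

/-! ### Entropy -/

/-- A closed cycle without backtracking `(e_0, e_1, …, e_n = e_0)`, `n ≥ 1`. -/
def IsClosedCycle (γ : Σ n : ℕ, (Fin (n + 1) → DirEdge k)) : Prop :=
  1 ≤ γ.1 ∧ γ.2 (Fin.last γ.1) = γ.2 0 ∧
    ∀ i : Fin γ.1, G.Adm (γ.2 i.castSucc) (γ.2 i.succ)

/-- The length `l(e_0) + ⋯ + l(e_{n-1})` of `(e_0, e_1, …, e_n)`. -/
def cycleLength (l : Fin k → ℝ) (γ : Σ n : ℕ, (Fin (n + 1) → DirEdge k)) : ℝ :=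
  ∑ i : Fin γ.1, l (γ.2 i.castSucc).1

/-- `h(l) = h`: the limit that defines the entropy of the metric graph exists and equals `h`. -/
def HasEntropy (l : Fin k → ℝ) (h : ℝ) : Prop :=
  Tendsto (fun T : ℝ =>
    1 / T * Real.log ({γ | G.IsClosedCycle γ ∧ cycleLength l γ < T}.ncard : ℝ)) atTop (𝓝 h)

/-- The space of all positive edge weightings of entropy one. -/
def entropyOne : Set (Fin k → ℝ) := {l | (∀ i, 0 < l i) ∧ G.HasEntropy l 1}

/-! ### The one-sided subshift of finite type -/

/-- The space of one-sided infinite paths without backtracking, with the product topology and the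
product σ-algebra. -/
abbrev PathSpace : Type := {e : ℕ → DirEdge k // ∀ n, G.Adm (e n) (e (n + 1))}

/-- The shift map. -/
def shift (e : G.PathSpace) : G.PathSpace := ⟨fun n => e.1 (n + 1), fun n => e.2 (n + 1)⟩

/-- A function on the edges as a locally constant function of the zeroth edge of a path. -/
def edgeFun (φ : Fin k → ℝ) (e : G.PathSpace) : ℝ := φ (e.1 0).1

/-- The transfer operator `(L_f w)(x) = ∑_{σ y = x} exp (f y) * w y` (a finite sum). -/
def transfer (f w : G.PathSpace → ℝ) (x : G.PathSpace) : ℝ :=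
  ∑ᶠ (y : G.PathSpace) (_ : G.shift y = x), Real.exp (f y) * w y

/-- Ruelle–Perron–Frobenius data of `f`: an eigenvalue `β > 0` with a strictly positive continuous
eigenfunction `v` of the transfer operator (such a `β` is its spectral radius on the continuous
functions, so that the pressure of `f` is `log β`), and a probability measure `μ` that is an
eigenmeasure of the dual operator for `β`. -/
structure IsRPF (f : G.PathSpace → ℝ) (β : ℝ) (v : G.PathSpace → ℝ)
    (μ : Measure G.PathSpace) : Prop where
  beta_pos : 0 < β
  cont : Continuous v
  pos : ∀ x, 0 < v x
  eigen : ∀ x, G.transfer f v x = β * v x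
  prob : IsProbabilityMeasure μ
  dual : ∀ φ : C(G.PathSpace, ℝ), ∫ x, G.transfer f φ x ∂μ = β * ∫ x, φ x ∂μ

/-- `m` is the equilibrium state `v μ / ∫ v dμ` of the function `f` of pressure zero
(`β = 1`). -/
def IsEquilibriumState (f : G.PathSpace → ℝ) (m : Measure G.PathSpace) : Prop :=
  ∃ (v : G.PathSpace → ℝ) (μ : Measure G.PathSpace), G.IsRPF f 1 v μ ∧
    m = μ.withDensity (fun x => ENNReal.ofReal (v x / ∫ y, v y ∂μ))

open Classical in
/-- The equilibrium state of a function of pressure zero. -/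
def equilibriumState (f : G.PathSpace → ℝ) : Measure G.PathSpace :=
  if h : ∃ m, G.IsEquilibriumState f m then h.choose else 0

/-- The sequence `(1/n) ∫ (w^n - n ∫ w dμ)² dμ`, with `w^n` the `n`-th Birkhoff sum of `w`. -/
def varianceSeq (w : G.PathSpace → ℝ) (μ : Measure G.PathSpace) (n : ℕ) : ℝ :=
  1 / (n : ℝ) * ∫ x, (birkhoffSum G.shift w n x - n * ∫ y, w y ∂μ) ^ 2 ∂μ

/-- The (asymptotic) variance `Var(w, μ)`, the limit of `varianceSeq`. -/
def dynVariance (w : G.PathSpace → ℝ) (μ : Measure G.PathSpace) : ℝ :=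
  limUnder atTop (G.varianceSeq w μ)

/-! ### The pressure metric -/

/-- The measure `m_{-l}`. -/
def state (l : Fin k → ℝ) : Measure G.PathSpace := G.equilibriumState (G.edgeFun (-l))

/-- `φ` is tangent to the space of entropy-one weightings at `l`: `∫ φ dm_{-l} = 0`. -/
def IsTangent (l φ : Fin k → ℝ) : Prop := ∫ e, G.edgeFun φ e ∂(G.state l) = 0

/-- The pressure norm of `φ` at `l`: `‖φ‖_P² = Var(φ, m_{-l})`. -/
def pressureNorm (l φ : Fin k → ℝ) : ℝ := √(G.dynVariance (G.edgeFun φ) (G.state l))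

/-- The pressure length of a curve `[0,1] → M`. -/
def pressureLength (γ : ℝ → Fin k → ℝ) : ℝ≥0∞ :=
  ∫⁻ t in Icc (0 : ℝ) 1,
    ENNReal.ofReal (G.pressureNorm (γ t) (derivWithin γ (Icc (0 : ℝ) 1) t))

/-- `γ : [0,1] → M` is a continuously differentiable curve of entropy-one weightings from `p` to
`q`. -/
structure IsCurve (p q : Fin k → ℝ) (γ : ℝ → Fin k → ℝ) : Prop where
  contDiffOn : ContDiffOn ℝ 1 γ (Icc 0 1)
  mem : ∀ t ∈ Icc (0 : ℝ) 1, γ t ∈ G.entropyOne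
  source : γ 0 = p
  target : γ 1 = q

/-- The path distance of the pressure metric: the infimum of the lengths of the `C¹` curves from
`p` to `q`. -/
def pressureDist (p q : G.entropyOne) : ℝ≥0∞ :=
  ⨅ (γ : ℝ → Fin k → ℝ) (_ : G.IsCurve p q γ), G.pressureLength γ

end UGraph

/-- `d` is a (finite-valued) metric on `X`, and `X` with the metric `d` is not complete. -/
def IsIncompleteMetric {X : Type} (d : X → X → ℝ≥0∞) : Prop :=
  ∃ _ : MetricSpace X, (∀ p q : X, edist p q = d p q) ∧ ¬ CompleteSpace X

/-- The figure-8 graph: one vertex and two loops. -/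
def figureEight : UGraph Unit 2 where
  fst := fun _ => ()
  snd := fun _ => ()

/-- The curve `c(x) = (x, -log ((1 - e^{-x}) / (1 + 3 e^{-x})))`. -/
def eightCurve (x : ℝ) : Fin 2 → ℝ :=
  ![x, -Real.log ((1 - Real.exp (-x)) / (1 + 3 * Real.exp (-x)))]

end MetricGraph

end

open MetricGraph

/-!
Weight the transition from an edge `e` to an edge `f` that may follow it by `exp (-l e)`. When this
matrix has a positive right eigenvector `u` and a positive left eigenvector `v` of eigenvalue one,
`u` bounds the number of closed cycles from above and below by multiples of `exp T`, up to a factor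
`T`, so the entropy is one; `v` is an eigenfunction of the transfer operator, and the Markov chain
with transition probabilities `exp (-l e) * u f / u e` is an eigenmeasure. Irreducibility makes
both unique. If moreover `v φ` is an eigenvector of the left action with eigenvalue `c`, where
`|c| < 1`, the correlations of `φ` along the orbit are geometric and the variance is
`(1 + c) / (1 - c) * ∫ φ²`.

For the figure-8 graph, `a = exp (-l 0)` and `b = exp (-l 1)`, eigenvalue one means
`(1 - a) (1 - b) = 4 a b`, which is the curve `eightCurve`; since entropy scales inversely with
`l`, no other weighting has entropy one. The tangent functions satisfy the eigenvector condition
with `c = a + b - 1`, which gives the speed of the curve. The speed is at most `2 / √x`, hence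
integrable at `0`, and the arc length from `0` is an isometry of the curve onto an interval that is
open at `0`.
-/

noncomputable section

namespace MetricGraph

/-! ### Preliminaries on real functions -/

theorem exists_pos_forall_le {ι : Type*} [Finite ι] {f : ι → ℝ} (hf : ∀ i, 0 < f i) :
    ∃ δ > 0, ∀ i, δ ≤ f i := by
  rcases isEmpty_or_nonempty ι with hempty | hnonempty
  · exact ⟨1, one_pos, fun i => hempty.elim i⟩
  · obtain ⟨i, hi⟩ := Finite.exists_min f
    exact ⟨f i, hf i, hi⟩

theorem tendsto_inv_mul_log_of_exp_bounds {N : ℝ → ℝ} {c C : ℝ} (hc : 0 < c) (hC : 0 < C)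
    (hlower : ∀ᶠ T in atTop, c * Real.exp T ≤ N T)
    (hupper : ∀ᶠ T in atTop, N T ≤ C * T * Real.exp T) :
    Tendsto (fun T => 1 / T * Real.log (N T)) atTop (𝓝 1) := by
  have hconst : ∀ a : ℝ, Tendsto (fun T : ℝ => a / T) atTop (𝓝 0) := fun a =>
    tendsto_const_nhds.div_atTop tendsto_id
  have hlog : Tendsto (fun T : ℝ => Real.log T / T) atTop (𝓝 0) :=
    Real.isLittleO_log_id_atTop.tendsto_div_nhds_zero
  have hlow : Tendsto (fun T : ℝ => 1 + Real.log c / T) atTop (𝓝 1) := by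
    simpa using (hconst (Real.log c)).const_add 1
  have hup : Tendsto (fun T : ℝ => 1 + (Real.log C / T + Real.log T / T)) atTop (𝓝 1) := by
    simpa using ((hconst (Real.log C)).add hlog).const_add 1
  refine tendsto_of_tendsto_of_tendsto_of_le_of_le' hlow hup ?_ ?_
  · filter_upwards [hlower, eventually_gt_atTop 0] with T hN hT
    calc 1 + Real.log c / T = 1 / T * Real.log (c * Real.exp T) := by
          rw [Real.log_mul hc.ne' (Real.exp_ne_zero T), Real.log_exp]
          field_simp
          ring
      _ ≤ 1 / T * Real.log (N T) := by gcongr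
  · filter_upwards [hlower, hupper, eventually_gt_atTop 0] with T hN hN' hT
    have hNpos : 0 < N T := (by positivity : 0 < c * Real.exp T).trans_le hN
    calc 1 / T * Real.log (N T) ≤ 1 / T * Real.log (C * T * Real.exp T) := by gcongr
      _ = 1 + (Real.log C / T + Real.log T / T) := by
          rw [Real.log_mul (by positivity) (Real.exp_ne_zero T), Real.log_mul hC.ne' hT.ne',
            Real.log_exp]
          field_simp
          ring

/-! ### Asymptotic variance of a function that decorrelates geometrically -/

section Variance

theorem tendsto_of_affine_recursion {V c : ℝ} (hc : |c| < 1) {q : ℕ → ℝ} (hq₀ : q 0 = 0)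
    (hq : ∀ n, q (n + 1) = V + c * q n) : Tendsto q atTop (𝓝 (V / (1 - c))) := by
  have hsum : ∀ n, q n = V * ∑ i ∈ Finset.range n, c ^ i := by
    intro n
    induction n with
    | zero => simp [hq₀]
    | succ n ih =>
      rw [hq, ih, geom_sum_succ]
      ring
  rw [funext hsum, div_eq_mul_inv]
  exact (hasSum_geometric_of_abs_lt_one hc).tendsto_sum_nat.const_mul V

variable {X : Type*} [TopologicalSpace X] {T : X → X} {φ : X → ℝ}

theorem continuous_birkhoffSum (hT : Continuous T) (hφ : Continuous φ) (n : ℕ) :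
    Continuous (birkhoffSum T φ n) :=
  continuous_finsetSum _ fun i _ => hφ.comp (hT.iterate i)

variable [CompactSpace X] [MeasurableSpace X] [OpensMeasurableSpace X] {m : Measure X}
  [IsFiniteMeasure m] {c : ℝ}

theorem integrable_of_continuous {f : X → ℝ} (hf : Continuous f) : Integrable f m :=
  hf.integrable_of_hasCompactSupport (HasCompactSupport.of_compactSpace f)

theorem integral_mul_birkhoffSum_succ (hT : Continuous T) (hφ : Continuous φ)
    (hdecorr : ∀ w : X → ℝ, Continuous w → ∫ x, φ x * w (T x) ∂m = c * ∫ x, φ x * w x ∂m)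
    (n : ℕ) :
    ∫ x, φ x * birkhoffSum T φ (n + 1) x ∂m =
      ∫ x, φ x ^ 2 ∂m + c * ∫ x, φ x * birkhoffSum T φ n x ∂m := by
  have hS := continuous_birkhoffSum hT hφ n
  calc ∫ x, φ x * birkhoffSum T φ (n + 1) x ∂m
      = ∫ x, φ x ^ 2 + φ x * birkhoffSum T φ n (T x) ∂m := by
        simp only [birkhoffSum_succ', mul_add, sq]
    _ = ∫ x, φ x ^ 2 ∂m + ∫ x, φ x * birkhoffSum T φ n (T x) ∂m := by
        rw [integral_add] <;> exact integrable_of_continuous (by fun_prop)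
    _ = ∫ x, φ x ^ 2 ∂m + c * ∫ x, φ x * birkhoffSum T φ n x ∂m := by rw [hdecorr _ hS]

theorem integral_birkhoffSum_succ_sq (hT : Continuous T) (hφ : Continuous φ)
    (hinv : ∀ w : X → ℝ, Continuous w → ∫ x, w (T x) ∂m = ∫ x, w x ∂m)
    (hdecorr : ∀ w : X → ℝ, Continuous w → ∫ x, φ x * w (T x) ∂m = c * ∫ x, φ x * w x ∂m)
    (n : ℕ) :
    ∫ x, birkhoffSum T φ (n + 1) x ^ 2 ∂m = ∫ x, birkhoffSum T φ n x ^ 2 ∂m +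
      (∫ x, φ x ^ 2 ∂m + 2 * c * ∫ x, φ x * birkhoffSum T φ n x ∂m) := by
  have hS := continuous_birkhoffSum hT hφ n
  calc ∫ x, birkhoffSum T φ (n + 1) x ^ 2 ∂m
      = ∫ x, birkhoffSum T φ n (T x) ^ 2 +
          (φ x ^ 2 + 2 * (φ x * birkhoffSum T φ n (T x))) ∂m := by
        refine integral_congr_ae (ae_of_all _ fun x => ?_)
        simp only [birkhoffSum_succ']
        ring
    _ = ∫ x, birkhoffSum T φ n (T x) ^ 2 ∂m +
          (∫ x, φ x ^ 2 ∂m + 2 * ∫ x, φ x * birkhoffSum T φ n (T x) ∂m) := by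
        rw [integral_add, integral_add, integral_const_mul] <;>
          exact integrable_of_continuous (by fun_prop)
    _ = _ := by
        rw [hinv (fun x => birkhoffSum T φ n x ^ 2) (hS.pow 2), hdecorr _ hS, mul_assoc]

theorem tendsto_integral_birkhoffSum_sq (hT : Continuous T) (hφ : Continuous φ)
    (hinv : ∀ w : X → ℝ, Continuous w → ∫ x, w (T x) ∂m = ∫ x, w x ∂m)
    (hdecorr : ∀ w : X → ℝ, Continuous w → ∫ x, φ x * w (T x) ∂m = c * ∫ x, φ x * w x ∂m)
    (hc : |c| < 1) :
    Tendsto (fun n : ℕ => 1 / (n : ℝ) * ∫ x, birkhoffSum T φ n x ^ 2 ∂m) atTop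
      (𝓝 ((∫ x, φ x ^ 2 ∂m) * ((1 + c) / (1 - c)))) := by
  set V := ∫ x, φ x ^ 2 ∂m
  set q : ℕ → ℝ := fun n => ∫ x, φ x * birkhoffSum T φ n x ∂m with hq
  have hqlim : Tendsto q atTop (𝓝 (V / (1 - c))) :=
    tendsto_of_affine_recursion hc (by simp [hq])
      (integral_mul_birkhoffSum_succ hT hφ hdecorr)
  have hsum : ∀ n, ∫ x, birkhoffSum T φ n x ^ 2 ∂m =
      ∑ i ∈ Finset.range n, (V + 2 * c * q i) := by
    intro n
    induction n with
    | zero => simp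
    | succ n ih =>
      rw [integral_birkhoffSum_succ_sq hT hφ hinv hdecorr, ih, Finset.sum_range_succ]
  have hc' : 1 - c ≠ 0 := (sub_pos.2 (abs_lt.1 hc).2).ne'
  have hlimit : V + 2 * c * (V / (1 - c)) = V * ((1 + c) / (1 - c)) := by
    field_simp
    ring
  rw [← hlimit]
  exact (((hqlim.const_mul (2 * c)).const_add V).cesaro).congr fun n => by
    rw [hsum, one_div]

end Variance

namespace UGraph

variable {V : Type} {k : ℕ} {G : UGraph V k} {l : Fin k → ℝ} {u v : DirEdge k → ℝ}

/-! ### Perron vectors of the weighted transition matrix -/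

open Classical in
/-- The edges that may follow `e` in a path without backtracking. -/
def successors (G : UGraph V k) (e : DirEdge k) : Finset (DirEdge k) := {f | G.Adm e f}

open Classical in
/-- The edges that may precede `f` in a path without backtracking. -/
def predecessors (G : UGraph V k) (f : DirEdge k) : Finset (DirEdge k) := {e | G.Adm e f}

@[simp]
theorem mem_successors {e f : DirEdge k} : f ∈ G.successors e ↔ G.Adm e f := by
  simp [successors]

@[simp]
theorem mem_predecessors {e f : DirEdge k} : e ∈ G.predecessors f ↔ G.Adm e f := by
  simp [predecessors]

/-- Irreducibility of the transition matrix of a graph: any two directed edges are the ends of a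
path with at least one transition. -/
def IsIrreducible (G : UGraph V k) : Prop := ∀ e f, Relation.TransGen G.Adm e f

/-- A positive eigenvector, of eigenvalue one, of the transition matrix `exp (-l e) * A(e, f)`
acting on columns. -/
structure IsRightPerron (G : UGraph V k) (l : Fin k → ℝ) (u : DirEdge k → ℝ) : Prop where
  pos : ∀ e, 0 < u e
  eigen : ∀ e, Real.exp (-l e.1) * ∑ f ∈ G.successors e, u f = u e

/-- A positive eigenvector, of eigenvalue one, of the transition matrix `exp (-l e) * A(e, f)`
acting on rows. -/
structure IsLeftPerron (G : UGraph V k) (l : Fin k → ℝ) (v : DirEdge k → ℝ) : Prop where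
  pos : ∀ e, 0 < v e
  eigen : ∀ f, ∑ e ∈ G.predecessors f, Real.exp (-l e.1) * v e = v f

theorem eq_zero_of_nonneg_of_eigen {r : DirEdge k → ℝ} (hG : G.IsIrreducible)
    (hr : ∀ e, 0 ≤ r e) (heig : ∀ e, Real.exp (-l e.1) * ∑ f ∈ G.successors e, r f = r e)
    {e : DirEdge k} (he : r e = 0) (f : DirEdge k) : r f = 0 := by
  have step : ∀ a b, G.Adm a b → r a = 0 → r b = 0 := by
    intro a b hab ha
    have hsum : ∑ f ∈ G.successors a, r f = 0 := by
      simpa [ha, Real.exp_ne_zero] using heig a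
    exact (Finset.sum_eq_zero_iff_of_nonneg fun f _ => hr f).1 hsum b (mem_successors.2 hab)
  induction hG e f with
  | single h => exact step _ _ h he
  | tail _ h ih => exact step _ _ h ih

-- Subtract the largest multiple of `u` that keeps `q` nonnegative: the difference has a zero.
theorem IsRightPerron.exists_eq_smul (hu : G.IsRightPerron l u) (hG : G.IsIrreducible)
    {q : DirEdge k → ℝ} (hq : ∀ e, Real.exp (-l e.1) * ∑ f ∈ G.successors e, q f = q e) :
    ∃ c : ℝ, q = c • u := by
  rcases isEmpty_or_nonempty (DirEdge k) with hempty | hnonempty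
  · exact ⟨0, Subsingleton.elim _ _⟩
  obtain ⟨e₀, he₀⟩ := Finite.exists_min fun e => q e / u e
  refine ⟨q e₀ / u e₀, funext fun f => sub_eq_zero.1 ?_⟩
  refine eq_zero_of_nonneg_of_eigen (l := l) (r := q - (q e₀ / u e₀) • u) hG
    (fun e => ?_) (fun e => ?_) (e := e₀) ?_ f
  · simpa [Pi.sub_apply, sub_nonneg] using (le_div_iff₀ (hu.pos e)).1 (he₀ e)
  · simp only [Pi.sub_apply, Pi.smul_apply, smul_eq_mul, Finset.sum_sub_distrib, ← Finset.mul_sum,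
      mul_sub, mul_left_comm, hq, hu.eigen]
  · simp [(hu.pos e₀).ne']

theorem IsRightPerron.eigen_mul_exp (hu : G.IsRightPerron l u) (e : DirEdge k) (T : ℝ) :
    ∑ f ∈ G.successors e, u f * Real.exp (T - l e.1) = u e * Real.exp T := by
  rw [← Finset.sum_mul, ← hu.eigen e, sub_eq_add_neg, Real.exp_add]
  ring

/-! ### Counting paths -/

open Classical in
/-- The paths `(e_0, …, e_n)` without backtracking from `e_0 = e` to `e_n = f` of length less than
`T`; as for closed cycles, the last edge does not count for the length. -/
def boundedPaths (G : UGraph V k) (l : Fin k → ℝ) (n : ℕ) (e f : DirEdge k) (T : ℝ) :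
    Finset (Fin (n + 1) → DirEdge k) :=
  {γ | γ 0 = e ∧ γ (Fin.last n) = f ∧ (∀ i : Fin n, G.Adm (γ i.castSucc) (γ i.succ)) ∧
    ∑ i : Fin n, l (γ i.castSucc).1 < T}

/-- The number of paths without backtracking from `e` to `f` with `n` transitions and of length
less than `T`. -/
def pathCount (G : UGraph V k) (l : Fin k → ℝ) (n : ℕ) (e f : DirEdge k) (T : ℝ) : ℕ :=
  (G.boundedPaths l n e f T).card

theorem mem_boundedPaths {n : ℕ} {e f : DirEdge k} {T : ℝ} {γ : Fin (n + 1) → DirEdge k} :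
    γ ∈ G.boundedPaths l n e f T ↔ γ 0 = e ∧ γ (Fin.last n) = f ∧
      (∀ i : Fin n, G.Adm (γ i.castSucc) (γ i.succ)) ∧ ∑ i : Fin n, l (γ i.castSucc).1 < T := by
  simp [boundedPaths]

theorem cons_mem_boundedPaths {n : ℕ} {e f g : DirEdge k} {T : ℝ} {γ : Fin (n + 1) → DirEdge k}
    (hγ : γ 0 = g) :
    (Fin.cons e γ : Fin (n + 2) → DirEdge k) ∈ G.boundedPaths l (n + 1) e f T ↔
      G.Adm e g ∧ γ ∈ G.boundedPaths l n g f (T - l e.1) := by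
  simp only [mem_boundedPaths, Fin.cons_zero, Fin.forall_fin_succ, Fin.sum_univ_succ,
    ← Fin.succ_last, ← Fin.succ_castSucc, Fin.cons_succ, Fin.castSucc_zero, hγ, lt_sub_iff_add_lt',
    true_and]
  tauto

open Classical in
theorem pathCount_zero (e f : DirEdge k) (T : ℝ) :
    G.pathCount l 0 e f T = if e = f ∧ 0 < T then 1 else 0 := by
  have hpaths : G.boundedPaths l 0 e f T = if e = f ∧ 0 < T then {fun _ => e} else ∅ := by
    ext γ
    have hγ : γ = (fun _ => e) ↔ γ 0 = e := by
      simp [funext_iff, Fin.forall_fin_one]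
    split_ifs with h <;> simp [mem_boundedPaths, hγ] <;> grind
  rw [pathCount, hpaths]
  split_ifs <;> rfl

theorem pathCount_succ (n : ℕ) (e f : DirEdge k) (T : ℝ) :
    G.pathCount l (n + 1) e f T = ∑ g ∈ G.successors e, G.pathCount l n g f (T - l e.1) := by
  classical
  have hmaps : ∀ γ ∈ G.boundedPaths l (n + 1) e f T, γ 1 ∈ G.successors e := fun γ hγ => by
    obtain ⟨h0, -, hadm, -⟩ := mem_boundedPaths.1 hγ
    simpa [h0] using hadm 0
  rw [pathCount, Finset.card_eq_sum_card_fiberwise hmaps]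
  refine Finset.sum_congr rfl fun g hg => ?_
  have hfiber : {γ ∈ G.boundedPaths l (n + 1) e f T | γ 1 = g} =
      (G.boundedPaths l n g f (T - l e.1)).image (Fin.cons e) := by
    ext γ
    simp only [Finset.mem_filter, Finset.mem_image]
    constructor
    · rintro ⟨hγ, hγg⟩
      obtain rfl : γ 0 = e := (mem_boundedPaths.1 hγ).1
      rw [← Fin.cons_self_tail γ] at hγ
      exact ⟨Fin.tail γ, ((cons_mem_boundedPaths hγg).1 hγ).2, Fin.cons_self_tail γ⟩
    · rintro ⟨γ', hγ', rfl⟩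
      have hg' : γ' 0 = g := (mem_boundedPaths.1 hγ').1
      exact ⟨(cons_mem_boundedPaths hg').2 ⟨mem_successors.1 hg, hγ'⟩, hg'⟩
  rw [hfiber, Finset.card_image_of_injective _
    (Fin.cons_right_injective (α := fun _ => DirEdge k) e), pathCount]

theorem IsRightPerron.mul_pathCount_le (hu : G.IsRightPerron l u) (n : ℕ) (e f : DirEdge k)
    (T : ℝ) : u f * G.pathCount l n e f T ≤ u e * Real.exp T := by
  induction n generalizing e T with
  | zero =>
    rw [pathCount_zero]
    split_ifs with h
    · rw [h.1, Nat.cast_one]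
      exact mul_le_mul_of_nonneg_left (Real.one_le_exp h.2.le) (hu.pos f).le
    · simpa using mul_nonneg (hu.pos e).le (Real.exp_pos T).le
  | succ n ih =>
    rw [pathCount_succ, Nat.cast_sum, Finset.mul_sum, ← hu.eigen_mul_exp]
    exact Finset.sum_le_sum fun g _ => ih g _

theorem IsRightPerron.pathCount_self_le (hu : G.IsRightPerron l u) (n : ℕ) (e : DirEdge k)
    (T : ℝ) : (G.pathCount l n e e T : ℝ) ≤ Real.exp T :=
  le_of_mul_le_mul_left (hu.mul_pathCount_le n e e T) (hu.pos e)

theorem sum_pathCount_zero (e : DirEdge k) {T : ℝ} (hT : 0 < T) :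
    ∑ f, G.pathCount l 0 e f T = 1 := by
  classical
  simp [pathCount_zero, hT]

theorem sum_pathCount_succ (K : ℕ) (e : DirEdge k) (T : ℝ) :
    ∑ n ∈ Finset.range K, ∑ f, G.pathCount l (n + 1) e f T =
      ∑ g ∈ G.successors e, ∑ n ∈ Finset.range K, ∑ f, G.pathCount l n g f (T - l e.1) := by
  simp_rw [pathCount_succ]
  rw [Finset.sum_comm (s := G.successors e)]
  exact Finset.sum_congr rfl fun n _ => Finset.sum_comm

theorem IsRightPerron.le_sum_pathCount (hu : G.IsRightPerron l u) {c δ : ℝ} (hc : 0 ≤ c)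
    (hcu : ∀ e, c * u e * Real.exp (l e.1) ≤ 1) (hδ : ∀ i, δ ≤ l i) (K : ℕ) (e : DirEdge k)
    {T : ℝ} (hT : 0 < T) (hTK : T ≤ K * δ) :
    c * u e * Real.exp T ≤ (∑ n ∈ Finset.range K, ∑ f, G.pathCount l n e f T : ℕ) := by
  induction K generalizing e T with
  | zero => simp only [Nat.cast_zero, zero_mul] at hTK; linarith
  | succ K ih =>
    rw [Finset.sum_range_succ', sum_pathCount_zero e hT, sum_pathCount_succ]
    rcases le_or_gt T (l e.1) with hTl | hTl
    · calc c * u e * Real.exp T ≤ c * u e * Real.exp (l e.1) := by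
            have := (hu.pos e).le
            gcongr
        _ ≤ 1 := hcu e
        _ ≤ _ := by exact_mod_cast Nat.le_add_left 1 _
    · have hTK' : T - l e.1 ≤ K * δ := by
        push_cast at hTK
        linarith [hδ e.1]
      rw [mul_assoc, ← hu.eigen_mul_exp, Finset.mul_sum, Nat.cast_add, Nat.cast_sum]
      refine le_add_of_le_of_nonneg (Finset.sum_le_sum fun g _ => ?_) (Nat.cast_nonneg _)
      rw [← mul_assoc]
      exact ih g (sub_pos.2 hTl) hTK'

theorem pathCount_mono (n : ℕ) (e f : DirEdge k) : Monotone (G.pathCount l n e f) :=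
  fun _ _ hST => Finset.card_le_card fun γ hγ => by
    rw [mem_boundedPaths] at hγ ⊢
    exact ⟨hγ.1, hγ.2.1, hγ.2.2.1, hγ.2.2.2.trans_le hST⟩

theorem pathCount_le_pathCount_succ {f g : DirEdge k} (hfg : G.Adm f g) (n : ℕ) (e : DirEdge k)
    (S : ℝ) : G.pathCount l n e f S ≤ G.pathCount l (n + 1) e g (S + l f.1) := by
  classical
  induction n generalizing e S with
  | zero =>
    rw [pathCount_zero]
    split_ifs with h
    · obtain ⟨rfl, hS⟩ := h
      rw [pathCount_succ, add_sub_cancel_right]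
      refine le_trans ?_ (Finset.single_le_sum (fun _ _ => Nat.zero_le _) (mem_successors.2 hfg))
      simp [pathCount_zero, hS]
    · exact Nat.zero_le _
  | succ n ih =>
    rw [pathCount_succ, pathCount_succ (n + 1), add_sub_right_comm]
    exact Finset.sum_le_sum fun h _ => ih h _

theorem exists_pathCount_le_of_transGen {f g : DirEdge k} (hfg : Relation.TransGen G.Adm f g) :
    ∃ (m : ℕ) (d : ℝ), 1 ≤ m ∧
      ∀ n e S, G.pathCount l n e f S ≤ G.pathCount l (n + m) e g (S + d) := by
  induction hfg with
  | single h => exact ⟨1, l f.1, le_rfl, pathCount_le_pathCount_succ h⟩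
  | @tail a b _ h ih =>
    obtain ⟨m, d, hm, hle⟩ := ih
    refine ⟨m + 1, d + l a.1, by omega, fun n e S => (hle n e S).trans ?_⟩
    rw [← add_assoc, ← add_assoc]
    exact pathCount_le_pathCount_succ h (n + m) e (S + d)

theorem IsIrreducible.exists_pathCount_le (hG : G.IsIrreducible) (l : Fin k → ℝ) (g : DirEdge k) :
    ∃ (M : ℕ) (D : ℝ), ∀ f, ∃ m ∈ Finset.Icc 1 M,
      ∀ n e S, G.pathCount l n e f S ≤ G.pathCount l (n + m) e g (S + D) := by
  choose m d hm hle using fun f => exists_pathCount_le_of_transGen (l := l) (hG f g)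
  obtain ⟨M, hM⟩ := (Set.finite_range m).bddAbove
  obtain ⟨D, hD⟩ := (Set.finite_range d).bddAbove
  refine ⟨M, D, fun f => ⟨m f, Finset.mem_Icc.2 ⟨hm f, hM ⟨f, rfl⟩⟩, fun n e S => ?_⟩⟩
  exact (hle f n e S).trans (pathCount_mono _ _ _ (by linarith [hD ⟨f, rfl⟩]))

/-! ### Entropy -/

/-- The number of closed cycles of length less than `T`, whose exponential growth rate is the
entropy. It is meaningful for positive `l`, when there are finitely many such cycles. -/
def cycleCount (G : UGraph V k) (l : Fin k → ℝ) (T : ℝ) : ℕ :=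
  {γ | G.IsClosedCycle γ ∧ cycleLength l γ < T}.ncard

theorem mul_le_cycleLength {δ : ℝ} (hδ : ∀ i, δ ≤ l i) (γ : Σ n : ℕ, (Fin (n + 1) → DirEdge k)) :
    γ.1 * δ ≤ cycleLength l γ := by
  simpa [cycleLength] using Finset.card_nsmul_le_sum Finset.univ
    (fun i : Fin γ.1 => l (γ.2 i.castSucc).1) δ fun i _ => hδ _

theorem cycleCount_eq {δ : ℝ} (hδ₀ : 0 < δ) (hδ : ∀ i, δ ≤ l i) {K : ℕ} {T : ℝ}
    (hTK : T ≤ K * δ) :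
    G.cycleCount l T = ∑ n ∈ Finset.Ico 1 K, ∑ e, G.pathCount l n e e T := by
  classical
  have hset : {γ | G.IsClosedCycle γ ∧ cycleLength l γ < T} =
      ↑((Finset.Ico 1 K).sigma fun n => Finset.univ.biUnion fun e => G.boundedPaths l n e e T) := by
    ext ⟨n, γ⟩
    have hn : cycleLength l ⟨n, γ⟩ < T → n < K := fun h => by
      have : (n : ℝ) * δ < K * δ := (mul_le_cycleLength hδ ⟨n, γ⟩).trans_lt (h.trans_le hTK)
      exact_mod_cast lt_of_mul_lt_mul_right this hδ₀.le
    simp only [IsClosedCycle, cycleLength, Set.mem_ofPred_eq, Finset.coe_sigma, Set.mem_sigma_iff,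
      Finset.mem_coe, Finset.mem_Ico, Finset.mem_biUnion, Finset.mem_univ, true_and,
      mem_boundedPaths, exists_eq_left'] at hn ⊢
    tauto
  rw [cycleCount, hset, Set.ncard_coe_finset, Finset.card_sigma]
  refine Finset.sum_congr rfl fun n _ => Finset.card_biUnion fun e _ f _ hef => ?_
  refine Finset.disjoint_left.2 fun γ he hf => ?_
  exact hef ((mem_boundedPaths.1 he).1.symm.trans (mem_boundedPaths.1 hf).1)

theorem IsRightPerron.exists_cycleCount_le (hu : G.IsRightPerron l u) (hl : ∀ i, 0 < l i) :
    ∃ C > 0, ∀ᶠ T in atTop, (G.cycleCount l T : ℝ) ≤ C * T * Real.exp T := by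
  obtain ⟨δ, hδ₀, hδ⟩ := exists_pos_forall_le hl
  refine ⟨(1 / δ + 1) * (Fintype.card (DirEdge k) + 1), by positivity, ?_⟩
  filter_upwards [eventually_ge_atTop 1] with T hT
  have hK : T ≤ (⌈T / δ⌉₊ : ℝ) * δ := (div_le_iff₀ hδ₀).1 (Nat.le_ceil _)
  have hcard : ((Finset.Ico 1 ⌈T / δ⌉₊).card : ℝ) ≤ (1 / δ + 1) * T := by
    calc ((Finset.Ico 1 ⌈T / δ⌉₊).card : ℝ) ≤ ⌈T / δ⌉₊ := by
          rw [Nat.card_Ico]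
          exact_mod_cast Nat.sub_le _ _
      _ ≤ T / δ + 1 := (Nat.ceil_lt_add_one (by positivity)).le
      _ ≤ (1 / δ + 1) * T := by rw [add_mul, div_mul_eq_mul_div, one_mul]; linarith
  calc (G.cycleCount l T : ℝ)
      = ∑ n ∈ Finset.Ico 1 ⌈T / δ⌉₊, ∑ e, (G.pathCount l n e e T : ℝ) := by
        rw [cycleCount_eq hδ₀ hδ hK]
        push_cast
        rfl
    _ ≤ ∑ _n ∈ Finset.Ico 1 ⌈T / δ⌉₊, ∑ _e : DirEdge k, Real.exp T := by
        gcongr with n _ e _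
        exact hu.pathCount_self_le n e T
    _ = (Finset.Ico 1 ⌈T / δ⌉₊).card * (Fintype.card (DirEdge k) * Real.exp T) := by
        simp only [Finset.sum_const, nsmul_eq_mul, Finset.card_univ]
    _ ≤ (1 / δ + 1) * T * ((Fintype.card (DirEdge k) + 1) * Real.exp T) := by
        gcongr
        linarith
    _ = _ := by ring

theorem IsIrreducible.sum_pathCount_le (hG : G.IsIrreducible) (hl : ∀ i, 0 < l i) (e : DirEdge k) :
    ∃ D : ℝ, ∀ (K : ℕ) (T : ℝ),
      ∑ n ∈ Finset.range K, ∑ f, G.pathCount l n e f T ≤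
        Fintype.card (DirEdge k) * G.cycleCount l (T + D) := by
  obtain ⟨δ, hδ₀, hδ⟩ := exists_pos_forall_le hl
  obtain ⟨M, D, hMD⟩ := hG.exists_pathCount_le l e
  refine ⟨D, fun K T => ?_⟩
  rw [Finset.sum_comm, ← Finset.card_univ, ← smul_eq_mul]
  refine Finset.sum_le_card_nsmul _ _ _ fun f _ => ?_
  obtain ⟨m, hm, hle⟩ := hMD f
  rw [Finset.mem_Icc] at hm
  let K' := K + M + ⌈(T + D) / δ⌉₊
  have hK' : T + D ≤ (K' : ℝ) * δ := by
    rw [← div_le_iff₀ hδ₀]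
    exact (Nat.le_ceil _).trans (by exact_mod_cast Nat.le_add_left _ _)
  rw [cycleCount_eq hδ₀ hδ hK']
  calc ∑ n ∈ Finset.range K, G.pathCount l n e f T
      ≤ ∑ n ∈ Finset.range K, G.pathCount l (n + m) e e (T + D) :=
        Finset.sum_le_sum fun n _ => hle n e T
    _ = ∑ n ∈ Finset.Ico m (K + m), G.pathCount l n e e (T + D) := by
        rw [Finset.range_eq_Ico, Finset.sum_Ico_add' (fun n => G.pathCount l n e e (T + D)),
          zero_add]
    _ ≤ ∑ n ∈ Finset.Ico 1 K', G.pathCount l n e e (T + D) :=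
        Finset.sum_le_sum_of_subset (Finset.Ico_subset_Ico hm.1 (by omega))
    _ ≤ ∑ n ∈ Finset.Ico 1 K', ∑ e, G.pathCount l n e e (T + D) :=
        Finset.sum_le_sum fun n _ => Finset.single_le_sum
          (f := fun e => G.pathCount l n e e (T + D)) (fun _ _ => Nat.zero_le _)
          (Finset.mem_univ e)

theorem IsRightPerron.exists_le_cycleCount [Nonempty (DirEdge k)] (hu : G.IsRightPerron l u)
    (hG : G.IsIrreducible) (hl : ∀ i, 0 < l i) :
    ∃ c > 0, ∀ᶠ T in atTop, c * Real.exp T ≤ G.cycleCount l T := by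
  obtain ⟨e⟩ := ‹Nonempty (DirEdge k)›
  obtain ⟨δ, hδ₀, hδ⟩ := exists_pos_forall_le hl
  have hpos : ∀ f, 0 < u f * Real.exp (l f.1) := fun f => mul_pos (hu.pos f) (Real.exp_pos _)
  obtain ⟨c, hc, hcu⟩ := exists_pos_forall_le fun f => one_div_pos.2 (hpos f)
  obtain ⟨D, hD⟩ := hG.sum_pathCount_le hl e
  have hcard : 0 < (Fintype.card (DirEdge k) : ℝ) := by exact_mod_cast Fintype.card_pos_iff.2 ⟨e⟩
  refine ⟨c * u e * Real.exp (-D) / Fintype.card (DirEdge k),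
    by have := hu.pos e; positivity, ?_⟩
  filter_upwards [eventually_gt_atTop D] with T hT
  have hlower := hu.le_sum_pathCount hc.le
    (fun f => (mul_assoc _ _ _).trans_le ((le_div_iff₀ (hpos f)).1 (hcu f))) hδ ⌈(T - D) / δ⌉₊ e
    (sub_pos.2 hT) ((div_le_iff₀ hδ₀).1 (Nat.le_ceil _))
  have hupper := hD ⌈(T - D) / δ⌉₊ (T - D)
  rw [sub_add_cancel] at hupper
  rw [div_mul_eq_mul_div, div_le_iff₀' hcard]
  calc c * u e * Real.exp (-D) * Real.exp T = c * u e * Real.exp (T - D) := by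
        rw [sub_eq_neg_add, Real.exp_add]
        ring
    _ ≤ _ := hlower
    _ ≤ _ := by exact_mod_cast hupper

theorem IsRightPerron.hasEntropy_one [Nonempty (DirEdge k)] (hu : G.IsRightPerron l u)
    (hG : G.IsIrreducible) (hl : ∀ i, 0 < l i) : G.HasEntropy l 1 := by
  obtain ⟨c, hc, hlower⟩ := hu.exists_le_cycleCount hG hl
  obtain ⟨C, hC, hupper⟩ := hu.exists_cycleCount_le hl
  exact tendsto_inv_mul_log_of_exp_bounds hc hC hlower hupper

theorem HasEntropy.of_smul {s h : ℝ} (hs : 0 < s) (hl : G.HasEntropy (s • l) h) :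
    G.HasEntropy l (s * h) := by
  refine ((hl.comp (tendsto_id.const_mul_atTop hs)).const_mul s).congr' ?_
  filter_upwards [eventually_gt_atTop 0] with T hT
  have hlength : ∀ γ, cycleLength (s • l) γ < s * T ↔ cycleLength l γ < T := fun γ => by
    have hsmul : cycleLength (s • l) γ = s * cycleLength l γ := by
      simp [cycleLength, Finset.mul_sum]
    rw [hsmul, mul_lt_mul_iff_right₀ hs]
  simp only [Function.comp, id, hlength]
  field_simp

/-! ### The path space -/

theorem continuous_coord (n : ℕ) : Continuous fun x : G.PathSpace => x.1 n :=
  (continuous_apply n).comp continuous_subtype_val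

theorem continuous_shift : Continuous G.shift :=
  Continuous.subtype_mk (continuous_pi fun n => continuous_coord (n + 1)) _

theorem continuous_comp_coord_zero {Y : Type*} [TopologicalSpace Y] (g : DirEdge k → Y) :
    Continuous fun x : G.PathSpace => g (x.1 0) :=
  continuous_of_discreteTopology.comp (continuous_coord 0)

instance : CompactSpace G.PathSpace := by
  suffices h : IsClosed {e : ℕ → DirEdge k | ∀ n, G.Adm (e n) (e (n + 1))} from
    h.isClosedEmbedding_subtypeVal.compactSpace
  rw [Set.ofPred_forall]
  refine isClosed_iInter fun n => ?_
  exact (isClosed_discrete {p : DirEdge k × DirEdge k | G.Adm p.1 p.2}).preimage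
    (f := fun e : ℕ → DirEdge k => (e n, e (n + 1))) (by fun_prop)

theorem measure_ext_of_forall_integral_eq {μ ν : Measure G.PathSpace} [IsFiniteMeasure μ]
    [IsFiniteMeasure ν] (h : ∀ f : C(G.PathSpace, ℝ), ∫ x, f x ∂μ = ∫ x, f x ∂ν) : μ = ν := by
  have : TopologicalSpace.MetrizableSpace G.PathSpace :=
    Topology.IsEmbedding.subtypeVal.metrizableSpace
  let := TopologicalSpace.metrizableSpaceMetric G.PathSpace
  exact ext_of_forall_integral_eq_of_IsFiniteMeasure fun f => h f.toContinuousMap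

open Classical in
/-- The path `(e, x_0, x_1, …)`, or the junk value `x` if `x_0` may not follow `e`. -/
def prepend (e : DirEdge k) (x : G.PathSpace) : G.PathSpace :=
  if h : G.Adm e (x.1 0) then
    ⟨fun n => Nat.casesOn n e x.1, fun n => by
      cases n with
      | zero => exact h
      | succ n => exact x.2 n⟩
  else x

theorem prepend_zero {e : DirEdge k} {x : G.PathSpace} (h : G.Adm e (x.1 0)) :
    (prepend e x).1 0 = e := by
  simp [prepend, h]

theorem prepend_succ {e : DirEdge k} {x : G.PathSpace} (h : G.Adm e (x.1 0)) (n : ℕ) :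
    (prepend e x).1 (n + 1) = x.1 n := by
  simp [prepend, h]

theorem shift_prepend {e : DirEdge k} {x : G.PathSpace} (h : G.Adm e (x.1 0)) :
    G.shift (prepend e x) = x :=
  Subtype.ext (funext (prepend_succ h))

theorem prepend_shift (y : G.PathSpace) : prepend (y.1 0) (G.shift y) = y := by
  refine Subtype.ext (funext fun n => ?_)
  cases n with
  | zero => exact prepend_zero (y.2 0)
  | succ n => exact prepend_succ (y.2 0) n

theorem measurableSet_adm_coord_zero (e : DirEdge k) :
    MeasurableSet {x : G.PathSpace | G.Adm e (x.1 0)} :=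
  (continuous_coord 0).measurable (MeasurableSet.of_discrete (s := {f | G.Adm e f}))

theorem measurable_prepend (e : DirEdge k) :
    Measurable (prepend e : G.PathSpace → G.PathSpace) := by
  classical
  have hcoord : ∀ n, Measurable fun x : G.PathSpace => x.1 n := fun n =>
    (continuous_coord n).measurable
  refine Measurable.subtype_mk (f := fun x => (prepend e x).1) (measurable_pi_lambda _ fun n => ?_)
  have hprepend : (fun x => (prepend e x).1 n) = fun x : G.PathSpace =>
      if G.Adm e (x.1 0) then (Nat.casesOn n e x.1 : DirEdge k) else x.1 n := by
    ext1 x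
    by_cases h : G.Adm e (x.1 0) <;> simp [prepend, h]
  rw [hprepend]
  refine Measurable.ite (measurableSet_adm_coord_zero e) ?_ (hcoord n)
  cases n with
  | zero => exact measurable_const
  | succ n => exact hcoord n

theorem transfer_eq_sum (f w : G.PathSpace → ℝ) (x : G.PathSpace) :
    G.transfer f w x =
      ∑ e ∈ G.predecessors (x.1 0), Real.exp (f (prepend e x)) * w (prepend e x) := by
  have hfiber : {y | G.shift y = x} = (fun e => prepend e x) '' ↑(G.predecessors (x.1 0)) := by
    ext y
    simp only [Set.mem_ofPred_eq, Set.mem_image, Finset.mem_coe, mem_predecessors]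
    constructor
    · rintro rfl
      exact ⟨y.1 0, y.2 0, prepend_shift y⟩
    · rintro ⟨e, he, rfl⟩
      exact shift_prepend he
  have htransfer : G.transfer f w x =
      ∑ᶠ (y) (_ : y ∈ {y | G.shift y = x}), Real.exp (f y) * w y := rfl
  rw [htransfer, hfiber, finsum_mem_image, finsum_mem_coe_finset]
  intro e he e' he' heq
  rw [← prepend_zero (mem_predecessors.1 he), ← prepend_zero (mem_predecessors.1 he')]
  exact congrArg (fun y : G.PathSpace => y.1 0) heq

theorem transfer_mul_comp_shift (f g w : G.PathSpace → ℝ) :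
    G.transfer f (fun y => g y * w (G.shift y)) = fun x => G.transfer f g x * w x := by
  funext x
  rw [transfer_eq_sum, transfer_eq_sum, Finset.sum_mul]
  refine Finset.sum_congr rfl fun e he => ?_
  rw [shift_prepend (mem_predecessors.1 he), mul_assoc]

theorem transfer_edgeFun (l : Fin k → ℝ) (w : G.PathSpace → ℝ) (x : G.PathSpace) :
    G.transfer (G.edgeFun (-l)) w x =
      ∑ e ∈ G.predecessors (x.1 0), Real.exp (-l e.1) * w (prepend e x) := by
  rw [transfer_eq_sum]
  refine Finset.sum_congr rfl fun e he => ?_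
  simp only [edgeFun, prepend_zero (mem_predecessors.1 he), Pi.neg_apply]

theorem transfer_comp_coord_zero (l : Fin k → ℝ) (g : DirEdge k → ℝ) (x : G.PathSpace) :
    G.transfer (G.edgeFun (-l)) (fun y => g (y.1 0)) x =
      ∑ e ∈ G.predecessors (x.1 0), Real.exp (-l e.1) * g e := by
  rw [transfer_edgeFun]
  refine Finset.sum_congr rfl fun e he => ?_
  rw [prepend_zero (mem_predecessors.1 he)]

/-! ### Cylinders -/

/-- The paths that agree with `w` at the times `0, …, n - 1`. -/
def cylinder (G : UGraph V k) (w : ℕ → DirEdge k) (n : ℕ) : Set G.PathSpace :=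
  Subtype.val ⁻¹' PiNat.cylinder w n

theorem mem_cylinder {w : ℕ → DirEdge k} {n : ℕ} {x : G.PathSpace} :
    x ∈ G.cylinder w n ↔ ∀ i < n, x.1 i = w i :=
  Iff.rfl

theorem mem_cylinder_one {w : ℕ → DirEdge k} {x : G.PathSpace} :
    x ∈ G.cylinder w 1 ↔ x.1 0 = w 0 := by
  simp [mem_cylinder]

theorem measurableSet_cylinder (w : ℕ → DirEdge k) (n : ℕ) : MeasurableSet (G.cylinder w n) :=
  ((PiNat.isOpen_cylinder _ w n).preimage continuous_subtype_val).measurableSet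

theorem mem_cylinder_succ {w : ℕ → DirEdge k} {n : ℕ} {x : G.PathSpace} :
    x ∈ G.cylinder w (n + 1) ↔ x.1 0 = w 0 ∧ G.shift x ∈ G.cylinder (fun i => w (i + 1)) n := by
  simp only [mem_cylinder, Nat.forall_lt_succ_left, shift]

theorem isPiSystem_cylinder : IsPiSystem {s | ∃ w n, s = G.cylinder w n} := by
  rintro _ ⟨w, n, rfl⟩ _ ⟨w', n', rfl⟩ ⟨z, hz, hz'⟩
  refine ⟨z.1, max n n', ?_⟩
  ext x
  rw [mem_cylinder] at hz hz'
  simp only [Set.mem_inter_iff, mem_cylinder, lt_max_iff, or_imp, forall_and]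
  exact and_congr (forall₂_congr fun i hi => by rw [hz i hi])
    (forall₂_congr fun i hi => by rw [hz' i hi])

theorem generateFrom_cylinder :
    (inferInstance : MeasurableSpace G.PathSpace) =
      MeasurableSpace.generateFrom {s | ∃ w n, s = G.cylinder w n} := by
  have hbasis := (PiNat.isTopologicalBasis_cylinders fun _ => DirEdge k).isInducing
    (f := (Subtype.val : G.PathSpace → _)) Topology.IsInducing.subtypeVal
  have himage : Set.preimage (Subtype.val : G.PathSpace → _) ''
      {s | ∃ w n, s = PiNat.cylinder (E := fun _ => DirEdge k) w n} =
        {s | ∃ w n, s = G.cylinder w n} := by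
    ext s
    simp only [Set.mem_image, Set.mem_ofPred_eq, cylinder]
    constructor
    · rintro ⟨_, ⟨w, n, rfl⟩, rfl⟩
      exact ⟨w, n, rfl⟩
    · rintro ⟨w, n, rfl⟩
      exact ⟨_, ⟨w, n, rfl⟩, rfl⟩
  have : SecondCountableTopology G.PathSpace :=
    Topology.IsInducing.subtypeVal.secondCountableTopology
  rw [← himage, ← hbasis.borel_eq_generateFrom]
  exact BorelSpace.measurable_eq

theorem measureReal_coord_zero_mem (μ : Measure G.PathSpace) [IsFiniteMeasure μ]
    (s : Finset (DirEdge k)) :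
    μ.real {x | x.1 0 ∈ s} = ∑ e ∈ s, μ.real (G.cylinder (fun _ => e) 1) := by
  rw [← measureReal_biUnion_finset _ fun e _ => measurableSet_cylinder _ _]
  · congr 1
    ext x
    simp [mem_cylinder_one]
  · intro e _ f _ hef
    refine Set.disjoint_left.2 fun x hx hx' => hef ?_
    exact (mem_cylinder_one.1 hx).symm.trans (mem_cylinder_one.1 hx')

theorem measureReal_univ_eq_sum (μ : Measure G.PathSpace) [IsFiniteMeasure μ] :
    μ.real Set.univ = ∑ e, μ.real (G.cylinder (fun _ => e) 1) := by
  simpa using measureReal_coord_zero_mem μ Finset.univ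

theorem measure_ext_cylinder {μ ν : Measure G.PathSpace} [IsFiniteMeasure μ] [IsFiniteMeasure ν]
    (h : ∀ w n, μ.real (G.cylinder w (n + 1)) = ν.real (G.cylinder w (n + 1))) : μ = ν := by
  have huniv : μ Set.univ = ν Set.univ := by
    rw [← measureReal_eq_measureReal_iff, measureReal_univ_eq_sum, measureReal_univ_eq_sum]
    exact Finset.sum_congr rfl fun e _ => h _ 0
  refine ext_of_generate_finite _ generateFrom_cylinder isPiSystem_cylinder ?_ huniv
  rintro _ ⟨w, n, rfl⟩
  cases n with
  | zero => simpa [cylinder] using huniv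
  | succ n => exact (measureReal_eq_measureReal_iff).1 (h w n)

theorem integral_comp_coord_zero (μ : Measure G.PathSpace) [IsFiniteMeasure μ]
    (g : DirEdge k → ℝ) :
    ∫ x, g (x.1 0) ∂μ = ∑ e, μ.real (G.cylinder (fun _ => e) 1) * g e := by
  have hmap := integral_map (μ := μ) (continuous_coord (G := G) 0).measurable.aemeasurable
    (continuous_of_discreteTopology (f := g)).aestronglyMeasurable
  have := Measure.isFiniteMeasure_map μ fun x => x.1 0
  rw [← hmap, integral_fintype .of_finite]
  refine Finset.sum_congr rfl fun e _ => ?_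
  rw [map_measureReal_apply (continuous_coord 0).measurable (MeasurableSet.singleton e),
    smul_eq_mul]
  congr 2
  ext x
  simp [mem_cylinder_one]

/-! ### The dual transfer operator -/

/-- The dual of the transfer operator of `-l`: the measure `ν` with `∫ f dν = ∫ L f dμ`. -/
def dualTransfer (l : Fin k → ℝ) (μ : Measure G.PathSpace) : Measure G.PathSpace :=
  ∑ e : DirEdge k, ENNReal.ofReal (Real.exp (-l e.1)) •
    (μ.restrict {x | G.Adm e (x.1 0)}).map (prepend e)

instance (l : Fin k → ℝ) (μ : Measure G.PathSpace) [IsFiniteMeasure μ] :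
    IsFiniteMeasure (dualTransfer l μ) := by
  have : ∀ e : DirEdge k, IsFiniteMeasure (ENNReal.ofReal (Real.exp (-l e.1)) •
      (μ.restrict {x | G.Adm e (x.1 0)}).map (prepend e)) := fun e =>
    Measure.smul_finite _ ENNReal.ofReal_ne_top
  unfold dualTransfer
  infer_instance

theorem integral_dualTransfer (l : Fin k → ℝ) (μ : Measure G.PathSpace) [IsFiniteMeasure μ]
    {f : G.PathSpace → ℝ} (hf : Continuous f) :
    ∫ x, f x ∂(dualTransfer l μ) = ∫ x, G.transfer (G.edgeFun (-l)) f x ∂μ := by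
  classical
  have hint : ∀ e, Integrable f ((μ.restrict {x | G.Adm e (x.1 0)}).map (prepend e)) := fun e =>
    integrable_of_continuous hf
  have hint' : ∀ e, IntegrableOn (fun x => f (prepend e x)) {x | G.Adm e (x.1 0)} μ := fun e =>
    (hint e).comp_measurable (measurable_prepend e)
  have htransfer : ∀ x, G.transfer (G.edgeFun (-l)) f x = ∑ e, Real.exp (-l e.1) *
      {x | G.Adm e (x.1 0)}.indicator (fun x => f (prepend e x)) x := fun x => by
    simp [transfer_edgeFun, predecessors, Finset.sum_filter, Set.indicator_apply]
  simp only [htransfer]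
  rw [dualTransfer,
    integral_finsetSum_measure fun e _ => (hint e).smul_measure ENNReal.ofReal_ne_top,
    integral_finsetSum _ fun e _ =>
      ((hint' e).integrable_indicator (measurableSet_adm_coord_zero e)).const_mul _]
  refine Finset.sum_congr rfl fun e _ => ?_
  rw [integral_smul_measure, ENNReal.toReal_ofReal (Real.exp_pos _).le, integral_const_mul,
    integral_indicator (measurableSet_adm_coord_zero e), smul_eq_mul,
    integral_map (measurable_prepend e).aemeasurable hf.aestronglyMeasurable]

theorem dualTransfer_eq_self_iff {μ : Measure G.PathSpace} [IsFiniteMeasure μ] :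
    dualTransfer l μ = μ ↔
      ∀ f : C(G.PathSpace, ℝ), ∫ x, G.transfer (G.edgeFun (-l)) f x ∂μ = ∫ x, f x ∂μ := by
  refine ⟨fun h f => ?_, fun h => measure_ext_of_forall_integral_eq fun f => ?_⟩
  · rw [← integral_dualTransfer l μ f.continuous, h]
  · rw [integral_dualTransfer l μ f.continuous, h]

theorem prepend_mem_cylinder_succ {w : ℕ → DirEdge k} {n : ℕ} {e : DirEdge k} {x : G.PathSpace}
    (hx : G.Adm e (x.1 0)) :
    prepend e x ∈ G.cylinder w (n + 1) ↔ e = w 0 ∧ x ∈ G.cylinder (fun i => w (i + 1)) n := by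
  rw [mem_cylinder_succ, prepend_zero hx, shift_prepend hx]

theorem dualTransfer_real_cylinder (l : Fin k → ℝ) (μ : Measure G.PathSpace)
    (w : ℕ → DirEdge k) (n : ℕ) :
    (dualTransfer l μ).real (G.cylinder w (n + 1)) = Real.exp (-l (w 0).1) *
      μ.real (G.cylinder (fun i => w (i + 1)) n ∩ {x | G.Adm (w 0) (x.1 0)}) := by
  have hpre : ∀ e, prepend e ⁻¹' G.cylinder w (n + 1) ∩ {x | G.Adm e (x.1 0)} =
      if e = w 0 then G.cylinder (fun i => w (i + 1)) n ∩ {x | G.Adm e (x.1 0)} else ∅ := by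
    intro e
    ext x
    have := prepend_mem_cylinder_succ (w := w) (n := n) (e := e) (x := x)
    split_ifs <;> grind
  simp only [dualTransfer, measureReal_def, Measure.coe_finsetSum, Finset.sum_apply,
    Measure.smul_apply, smul_eq_mul, Measure.map_apply (measurable_prepend _)
      (measurableSet_cylinder _ _), Measure.restrict_apply
      (measurable_prepend _ (measurableSet_cylinder _ _)), hpre]
  rw [Finset.sum_eq_single (w 0) (fun e _ he => by simp [he]) (by simp), if_pos rfl,
    ENNReal.toReal_mul, ENNReal.toReal_ofReal (Real.exp_pos _).le]

theorem dualTransfer_real_cylinder_one (l : Fin k → ℝ) (μ : Measure G.PathSpace)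
    [IsFiniteMeasure μ] (w : ℕ → DirEdge k) :
    (dualTransfer l μ).real (G.cylinder w 1) =
      Real.exp (-l (w 0).1) * ∑ f ∈ G.successors (w 0), μ.real (G.cylinder (fun _ => f) 1) := by
  rw [dualTransfer_real_cylinder, ← measureReal_coord_zero_mem]
  simp [cylinder]

open Classical in
theorem dualTransfer_real_cylinder_add_two (l : Fin k → ℝ) (μ : Measure G.PathSpace)
    (w : ℕ → DirEdge k) (n : ℕ) :
    (dualTransfer l μ).real (G.cylinder w (n + 2)) =
      if G.Adm (w 0) (w 1) then
        Real.exp (-l (w 0).1) * μ.real (G.cylinder (fun i => w (i + 1)) (n + 1))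
      else 0 := by
  have hadm : ∀ x ∈ G.cylinder (fun i => w (i + 1)) (n + 1), x.1 0 = w 1 := fun x hx =>
    hx 0 n.succ_pos
  rw [dualTransfer_real_cylinder]
  split_ifs with h
  · congr 2
    exact Set.inter_eq_left.2 fun x hx => by simpa [hadm x hx] using h
  · have hempty : G.cylinder (fun i => w (i + 1)) (n + 1) ∩ {x | G.Adm (w 0) (x.1 0)} = ∅ :=
      Set.eq_empty_of_forall_notMem fun x hx => h (by simpa [hadm x hx.1] using hx.2)
    rw [hempty, measureReal_empty, mul_zero]

theorem eq_of_dualTransfer_eq_self {μ ν : Measure G.PathSpace} [IsFiniteMeasure μ]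
    [IsFiniteMeasure ν] (hμ : dualTransfer l μ = μ) (hν : dualTransfer l ν = ν)
    (h : ∀ e, μ.real (G.cylinder (fun _ => e) 1) = ν.real (G.cylinder (fun _ => e) 1)) :
    μ = ν := by
  classical
  refine measure_ext_cylinder fun w n => ?_
  induction n generalizing w with
  | zero =>
    rw [← hμ, ← hν, dualTransfer_real_cylinder_one, dualTransfer_real_cylinder_one]
    simp only [h]
  | succ n ih =>
    rw [← hμ, ← hν, dualTransfer_real_cylinder_add_two, dualTransfer_real_cylinder_add_two, ih]

theorem IsRightPerron.real_cylinder_one (hu : G.IsRightPerron l u) (hG : G.IsIrreducible)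
    {μ : Measure G.PathSpace} [IsProbabilityMeasure μ] (hμ : dualTransfer l μ = μ) (e : DirEdge k) :
    μ.real (G.cylinder (fun _ => e) 1) = u e / ∑ f, u f := by
  obtain ⟨c, hc⟩ := hu.exists_eq_smul hG (q := fun e => μ.real (G.cylinder (fun _ => e) 1))
    fun e => by conv_rhs => rw [← hμ, dualTransfer_real_cylinder_one]
  have hsum : c * ∑ f, u f = 1 := by
    rw [← probReal_univ (μ := μ), measureReal_univ_eq_sum, Finset.mul_sum]
    exact Finset.sum_congr rfl fun f _ => (congrFun hc f).symm
  rw [eq_div_iff (right_ne_zero_of_mul_eq_one hsum), congrFun hc e, Pi.smul_apply, smul_eq_mul,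
    mul_right_comm, hsum, one_mul]

theorem IsRightPerron.eq_of_dualTransfer_eq_self (hu : G.IsRightPerron l u)
    (hG : G.IsIrreducible) {μ ν : Measure G.PathSpace} [IsProbabilityMeasure μ]
    [IsProbabilityMeasure ν] (hμ : dualTransfer l μ = μ) (hν : dualTransfer l ν = ν) : μ = ν :=
  UGraph.eq_of_dualTransfer_eq_self hμ hν fun e => by
    rw [hu.real_cylinder_one hG hμ, hu.real_cylinder_one hG hν]

/-! ### Markov measures -/

/-- A choice, for every time and every edge, of an edge that follows. -/
abbrev SuccessorChoice (G : UGraph V k) : Type := ∀ p : ℕ × DirEdge k, G.successors p.2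

/-- The edges of the path that starts at `e` and follows the choices `c`. -/
def followEdge (e : DirEdge k) (c : G.SuccessorChoice) : ℕ → DirEdge k
  | 0 => e
  | n + 1 => c (n, followEdge e c n)

/-- The path that starts at `p.1` and follows the choices `p.2`. -/
def followPath (p : DirEdge k × G.SuccessorChoice) : G.PathSpace :=
  ⟨followEdge p.1 p.2, fun n => mem_successors.1 (p.2 (n, followEdge p.1 p.2 n)).2⟩

theorem measurable_followPath : Measurable (followPath (G := G)) := by
  refine Measurable.subtype_mk (f := fun p : DirEdge k × G.SuccessorChoice => followEdge p.1 p.2)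
    (measurable_pi_lambda _ fun n => ?_)
  induction n with
  | zero => exact measurable_fst
  | succ n ih =>
    refine measurable_to_countable' fun f => ?_
    have hpre : (fun p : DirEdge k × G.SuccessorChoice => followEdge p.1 p.2 (n + 1)) ⁻¹' {f} =
        ⋃ g : DirEdge k, (fun p => followEdge p.1 p.2 n) ⁻¹' {g} ∩
          (fun p => p.2 (n, g)) ⁻¹' {h | h.1 = f} := by
      ext p
      simp [followEdge]
    rw [hpre]
    exact MeasurableSet.iUnion fun g => (ih (MeasurableSet.singleton g)).inter
      (((measurable_pi_apply (n, g)).comp measurable_snd) MeasurableSet.of_discrete)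

theorem followPath_mem_cylinder {p : DirEdge k × G.SuccessorChoice} {w : ℕ → DirEdge k} {n : ℕ} :
    followPath p ∈ G.cylinder w (n + 1) ↔
      p.1 = w 0 ∧ ∀ i < n, (p.2 (i, w i) : DirEdge k) = w (i + 1) := by
  change (∀ i < n + 1, followEdge p.1 p.2 i = w i) ↔ _
  induction n with
  | zero => simp [followEdge]
  | succ n ih =>
    rw [Nat.forall_lt_succ_right, ih, Nat.forall_lt_succ_right, ← and_assoc]
    refine and_congr_right fun h => ?_
    rw [followEdge, ih.2 h n n.lt_succ_self]

/-- The law of the Markov chain with initial law `ι` and transition probabilities `κ`. -/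
def markovMeasure (ι : PMF (DirEdge k)) (κ : ∀ e, PMF (G.successors e)) : Measure G.PathSpace :=
  (ι.toMeasure.prod (Measure.infinitePi fun p : ℕ × DirEdge k => (κ p.2).toMeasure)).map followPath

instance (ι : PMF (DirEdge k)) (κ : ∀ e, PMF (G.successors e)) :
    IsProbabilityMeasure (markovMeasure ι κ) :=
  Measure.isProbabilityMeasure_map measurable_followPath.aemeasurable

theorem markovMeasure_cylinder (ι : PMF (DirEdge k)) (κ : ∀ e, PMF (G.successors e))
    (w : ℕ → DirEdge k) (n : ℕ) :
    markovMeasure ι κ (G.cylinder w (n + 1)) =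
      ι (w 0) * ∏ i ∈ Finset.range n, (κ (w i)).toMeasure {g | g.1 = w (i + 1)} := by
  classical
  have hbox : followPath ⁻¹' G.cylinder w (n + 1) = {w 0} ×ˢ
      Set.pi ↑((Finset.range n).image fun i => (i, w i)) fun p => {g | g.1 = w (p.1 + 1)} := by
    ext p
    simp [followPath_mem_cylinder, Set.mem_prod]
  rw [markovMeasure, Measure.map_apply measurable_followPath (measurableSet_cylinder _ _), hbox,
    Measure.prod_prod, PMF.toMeasure_apply_singleton _ _ (MeasurableSet.singleton _),
    Measure.infinitePi_pi _ fun p _ => MeasurableSet.of_discrete, Finset.prod_image]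
  exact fun i _ j _ hij => congrArg Prod.fst hij

/-- The normalisation of a right Perron vector, as initial law. -/
def IsRightPerron.initialLaw [Nonempty (DirEdge k)] (hu : G.IsRightPerron l u) :
    PMF (DirEdge k) :=
  PMF.ofFintype (fun e => ENNReal.ofReal (u e / ∑ f, u f)) (by
    have hsum : 0 < ∑ f, u f := Finset.sum_pos (fun f _ => hu.pos f) Finset.univ_nonempty
    rw [← ENNReal.ofReal_sum_of_nonneg fun e _ => (div_pos (hu.pos e) hsum).le,
      ← Finset.sum_div, div_self hsum.ne', ENNReal.ofReal_one])

/-- The transition probabilities `exp (-l e) * u f / u e` (Doob transform of the transition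
matrix by its Perron vector). -/
def IsRightPerron.transitionLaw (hu : G.IsRightPerron l u) (e : DirEdge k) :
    PMF (G.successors e) :=
  PMF.ofFintype (fun f => ENNReal.ofReal (Real.exp (-l e.1) * u f / u e)) (by
    have hnonneg : ∀ f : G.successors e, 0 ≤ Real.exp (-l e.1) * u f / u e := fun f =>
      (div_pos (mul_pos (Real.exp_pos _) (hu.pos f)) (hu.pos e)).le
    rw [← ENNReal.ofReal_sum_of_nonneg fun f _ => hnonneg f,
      Finset.sum_coe_sort (G.successors e) fun f => Real.exp (-l e.1) * u f / u e,
      ← Finset.sum_div, ← Finset.mul_sum, hu.eigen, div_self (hu.pos e).ne', ENNReal.ofReal_one])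

open Classical in
theorem IsRightPerron.transitionLaw_real (hu : G.IsRightPerron l u) (e f : DirEdge k) :
    (hu.transitionLaw e).toMeasure.real {g | g.1 = f} =
      if G.Adm e f then Real.exp (-l e.1) * u f / u e else 0 := by
  split_ifs with hf
  · have hsingleton : {g : G.successors e | g.1 = f} = {⟨f, mem_successors.2 hf⟩} := by
      ext g
      simp [Subtype.ext_iff]
    rw [hsingleton, measureReal_def,
      PMF.toMeasure_apply_singleton _ _ (MeasurableSet.singleton _)]
    exact ENNReal.toReal_ofReal (div_pos (mul_pos (Real.exp_pos _) (hu.pos f)) (hu.pos e)).le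
  · have hempty : {g : G.successors e | g.1 = f} = ∅ :=
      Set.eq_empty_of_forall_notMem fun g hg => hf (hg ▸ mem_successors.1 g.2)
    rw [hempty, measureReal_empty]

theorem IsRightPerron.markovMeasure_real_cylinder [Nonempty (DirEdge k)]
    (hu : G.IsRightPerron l u) (w : ℕ → DirEdge k) (n : ℕ) :
    (markovMeasure hu.initialLaw hu.transitionLaw).real (G.cylinder w (n + 1)) =
      u (w 0) / (∑ f, u f) *
        ∏ i ∈ Finset.range n, (hu.transitionLaw (w i)).toMeasure.real {g | g.1 = w (i + 1)} := by
  rw [measureReal_def, markovMeasure_cylinder, ENNReal.toReal_mul, ENNReal.toReal_prod]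
  congr 1
  exact ENNReal.toReal_ofReal
    (div_nonneg (hu.pos _).le (Finset.sum_nonneg fun f _ => (hu.pos f).le))

theorem IsRightPerron.dualTransfer_markovMeasure [Nonempty (DirEdge k)]
    (hu : G.IsRightPerron l u) :
    dualTransfer l (markovMeasure hu.initialLaw hu.transitionLaw) =
      markovMeasure hu.initialLaw hu.transitionLaw := by
  classical
  refine measure_ext_cylinder fun w n => ?_
  cases n with
  | zero =>
    rw [dualTransfer_real_cylinder_one]
    simp only [hu.markovMeasure_real_cylinder w 0,
      fun f => hu.markovMeasure_real_cylinder (fun _ => f) 0, Finset.range_zero,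
      Finset.prod_empty, mul_one]
    rw [← Finset.sum_div, ← mul_div_assoc, hu.eigen]
  | succ n =>
    have hw0 := (hu.pos (w 0)).ne'
    rw [dualTransfer_real_cylinder_add_two, hu.markovMeasure_real_cylinder,
      hu.markovMeasure_real_cylinder, Finset.prod_range_succ', hu.transitionLaw_real (w 0)]
    split_ifs
    · field_simp
    · simp

theorem IsLeftPerron.transfer_eq (hv : G.IsLeftPerron l v) (x : G.PathSpace) :
    G.transfer (G.edgeFun (-l)) (fun y => v (y.1 0)) x = v (x.1 0) := by
  rw [transfer_comp_coord_zero, hv.eigen]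

theorem IsRightPerron.isRPF [Nonempty (DirEdge k)] (hu : G.IsRightPerron l u)
    (hv : G.IsLeftPerron l v) :
    G.IsRPF (G.edgeFun (-l)) 1 (fun x => v (x.1 0))
      (markovMeasure hu.initialLaw hu.transitionLaw) where
  beta_pos := one_pos
  cont := continuous_comp_coord_zero v
  pos x := hv.pos (x.1 0)
  eigen x := by rw [one_mul, hv.transfer_eq]
  prob := inferInstance
  dual f := by rw [one_mul, dualTransfer_eq_self_iff.1 hu.dualTransfer_markovMeasure f]

/-! ### Equilibrium states -/

theorem IsIrreducible.exists_mem_coord_zero_eq (hG : G.IsIrreducible) {A : Set G.PathSpace}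
    (hne : A.Nonempty) (hA : ∀ x ∈ A, ∀ e, G.Adm e (x.1 0) → prepend e x ∈ A) (e : DirEdge k) :
    ∃ z ∈ A, z.1 0 = e := by
  obtain ⟨x, hx⟩ := hne
  induction (hG e (x.1 0)).to_reflTransGen using Relation.ReflTransGen.head_induction_on with
  | refl => exact ⟨x, hx, rfl⟩
  | head hadm _ ih =>
    obtain ⟨z, hz, rfl⟩ := ih
    exact ⟨prepend _ z, hA z hz _ hadm, prepend_zero hadm⟩

theorem IsIrreducible.exists_mem_cylinder (hG : G.IsIrreducible) {A : Set G.PathSpace}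
    (hne : A.Nonempty) (hA : ∀ x ∈ A, ∀ e, G.Adm e (x.1 0) → prepend e x ∈ A)
    (y : G.PathSpace) (n : ℕ) : ∃ z ∈ A, z ∈ G.cylinder y.1 (n + 1) := by
  induction n generalizing y with
  | zero =>
    obtain ⟨z, hz, hzy⟩ := hG.exists_mem_coord_zero_eq hne hA (y.1 0)
    exact ⟨z, hz, mem_cylinder_one.2 hzy⟩
  | succ n ih =>
    obtain ⟨z, hz, hzy⟩ := ih (G.shift y)
    have hadm : G.Adm (y.1 0) (z.1 0) := by
      rw [mem_cylinder.1 hzy 0 n.succ_pos]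
      exact y.2 0
    exact ⟨prepend (y.1 0) z, hA z hz _ hadm, (prepend_mem_cylinder_succ hadm).2 ⟨rfl, hzy⟩⟩

theorem IsIrreducible.eq_univ_of_prepend_mem (hG : G.IsIrreducible) {A : Set G.PathSpace}
    (hclosed : IsClosed A) (hne : A.Nonempty)
    (hA : ∀ x ∈ A, ∀ e, G.Adm e (x.1 0) → prepend e x ∈ A) : A = Set.univ := by
  refine Set.eq_univ_of_forall fun y => ?_
  choose z hz hzy using hG.exists_mem_cylinder hne hA y
  refine hclosed.mem_of_tendsto (f := z) (b := atTop) ?_ (Eventually.of_forall hz)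
  rw [tendsto_subtype_rng, tendsto_pi_nhds]
  intro i
  refine tendsto_const_nhds.congr' ?_
  filter_upwards [eventually_ge_atTop i] with n hn
  exact (mem_cylinder.1 (hzy n) i (Nat.lt_succ_of_le hn)).symm

/-- The set where `w / v` attains its minimum is closed under taking preimages of the shift. -/
theorem IsIrreducible.exists_eq_mul_of_transfer_eq (hG : G.IsIrreducible)
    {f v w : G.PathSpace → ℝ} {β : ℝ} (hv : Continuous v) (hw : Continuous w)
    (hpos : ∀ x, 0 < v x) (hLv : ∀ x, G.transfer f v x = β * v x)
    (hLw : ∀ x, G.transfer f w x = β * w x) : ∃ c : ℝ, ∀ x, w x = c * v x := by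
  rcases isEmpty_or_nonempty G.PathSpace with hempty | hnonempty
  · exact ⟨0, fun x => hempty.elim x⟩
  obtain ⟨x₀, -, hx₀⟩ := isCompact_univ.exists_isMinOn Set.univ_nonempty
    (hw.div hv fun x => (hpos x).ne').continuousOn
  set c := w x₀ / v x₀
  have hle : ∀ x, 0 ≤ w x - c * v x := fun x =>
    sub_nonneg.2 ((le_div_iff₀ (hpos x)).1 (hx₀ (Set.mem_univ x)))
  have huniv : {x | w x = c * v x} = Set.univ := by
    refine hG.eq_univ_of_prepend_mem (isClosed_eq hw (continuous_const.mul hv))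
      ⟨x₀, (div_mul_cancel₀ _ (hpos x₀).ne').symm⟩ fun x (hx : w x = c * v x) e he => ?_
    have hzero : ∑ e ∈ G.predecessors (x.1 0), Real.exp (f (prepend e x)) *
        (w (prepend e x) - c * v (prepend e x)) = 0 := by
      simp only [mul_sub, Finset.sum_sub_distrib, mul_left_comm _ c, ← Finset.mul_sum,
        ← transfer_eq_sum, hLv, hLw, hx]
      ring
    rw [Finset.sum_eq_zero_iff_of_nonneg fun e _ => mul_nonneg (Real.exp_pos _).le (hle _)]
      at hzero
    exact sub_eq_zero.1
      ((mul_eq_zero.1 (hzero e (mem_predecessors.2 he))).resolve_left (Real.exp_pos _).ne')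
  exact ⟨c, fun x => huniv.ge (Set.mem_univ x)⟩

/-- The measure `v μ / ∫ v dμ`. -/
def normalizedDensity (v : G.PathSpace → ℝ) (μ : Measure G.PathSpace) : Measure G.PathSpace :=
  μ.withDensity fun x => ENNReal.ofReal (v x / ∫ y, v y ∂μ)

section IsRPF

variable {f v : G.PathSpace → ℝ} {μ : Measure G.PathSpace} {β : ℝ}

theorem IsRPF.integral_pos (h : G.IsRPF f β v μ) : 0 < ∫ x, v x ∂μ := by
  have := h.prob
  rw [integral_pos_iff_support_of_nonneg (fun x => (h.pos x).le) (integrable_of_continuous h.cont),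
    Function.support_eq_univ fun x => (h.pos x).ne', measure_univ]
  exact one_pos

theorem IsRPF.integral_normalizedDensity (h : G.IsRPF f β v μ) (g : G.PathSpace → ℝ) :
    ∫ x, g x ∂(normalizedDensity v μ) = (∫ x, v x * g x ∂μ) / ∫ x, v x ∂μ := by
  rw [normalizedDensity, integral_withDensity_eq_integral_toReal_smul
    (h.cont.div_const _).measurable.ennreal_ofReal (ae_of_all _ fun x => ENNReal.ofReal_lt_top),
    ← integral_div]
  simp only [ENNReal.toReal_ofReal (div_pos (h.pos _) h.integral_pos).le, smul_eq_mul,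
    div_mul_eq_mul_div]

theorem IsRPF.isProbabilityMeasure_normalizedDensity (h : G.IsRPF f β v μ) :
    IsProbabilityMeasure (normalizedDensity v μ) := by
  have := h.prob
  constructor
  rw [normalizedDensity, withDensity_apply _ MeasurableSet.univ, Measure.restrict_univ,
    ← ofReal_integral_eq_lintegral_ofReal (integrable_of_continuous (h.cont.div_const _))
      (ae_of_all _ fun x => (div_pos (h.pos x) h.integral_pos).le),
    integral_div, div_self h.integral_pos.ne', ENNReal.ofReal_one]

/-- The dual of `w ↦ w ∘ σ` with respect to `v μ` is the transfer operator conjugated by `v`. -/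
theorem IsRPF.integral_mul_comp_shift (h : G.IsRPF f 1 v μ) {φ : G.PathSpace → ℝ} {c : ℝ}
    (hφ : Continuous φ) (heig : ∀ x, G.transfer f (fun y => v y * φ y) x = c * (v x * φ x))
    {w : G.PathSpace → ℝ} (hw : Continuous w) :
    ∫ x, φ x * w (G.shift x) ∂(normalizedDensity v μ) =
      c * ∫ x, φ x * w x ∂(normalizedDensity v μ) := by
  have hdual := h.dual ⟨fun x => v x * φ x * w (G.shift x),
    (h.cont.mul hφ).mul (hw.comp continuous_shift)⟩
  simp only [ContinuousMap.coe_mk, one_mul, transfer_mul_comp_shift, heig] at hdual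
  simp only [mul_assoc, integral_const_mul] at hdual
  rw [h.integral_normalizedDensity, h.integral_normalizedDensity, ← hdual, mul_div_assoc]

theorem IsRPF.integral_comp_shift (h : G.IsRPF f 1 v μ) {w : G.PathSpace → ℝ}
    (hw : Continuous w) :
    ∫ x, w (G.shift x) ∂(normalizedDensity v μ) = ∫ x, w x ∂(normalizedDensity v μ) := by
  simpa using h.integral_mul_comp_shift (φ := fun _ => 1) (c := 1) continuous_const
    (by simpa using h.eigen) hw

theorem IsRPF.normalizedDensity_eq (h : G.IsRPF f β v μ) (hG : G.IsIrreducible)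
    {w : G.PathSpace → ℝ} (hw : G.IsRPF f β w μ) :
    normalizedDensity w μ = normalizedDensity v μ := by
  have := h.prob
  obtain ⟨x⟩ := nonempty_of_isProbabilityMeasure μ
  obtain ⟨c, hc⟩ := hG.exists_eq_mul_of_transfer_eq h.cont hw.cont h.pos h.eigen hw.eigen
  have hc₀ : c ≠ 0 := left_ne_zero_of_mul (hc x ▸ (hw.pos x).ne')
  simp only [normalizedDensity, hc, integral_const_mul, mul_div_mul_left _ _ hc₀]

end IsRPF

section PerronState

variable [Nonempty (DirEdge k)]

/-- The Markov measure of `u`, reweighted by `v`. -/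
def IsRightPerron.markovState (hu : G.IsRightPerron l u) (v : DirEdge k → ℝ) :
    Measure G.PathSpace :=
  normalizedDensity (fun x => v (x.1 0)) (markovMeasure hu.initialLaw hu.transitionLaw)

theorem IsRightPerron.isEquilibriumState_iff (hu : G.IsRightPerron l u) (hv : G.IsLeftPerron l v)
    (hG : G.IsIrreducible) {m : Measure G.PathSpace} :
    G.IsEquilibriumState (G.edgeFun (-l)) m ↔ m = hu.markovState v := by
  constructor
  · rintro ⟨w, μ, hw, rfl⟩
    have := hw.prob
    have hμ : μ = markovMeasure hu.initialLaw hu.transitionLaw :=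
      hu.eq_of_dualTransfer_eq_self hG
        (dualTransfer_eq_self_iff.2 fun f => by rw [hw.dual, one_mul])
        hu.dualTransfer_markovMeasure
    subst hμ
    exact (hu.isRPF hv).normalizedDensity_eq hG hw
  · rintro rfl
    exact ⟨_, _, hu.isRPF hv, rfl⟩

theorem IsRightPerron.existsUnique_isEquilibriumState (hu : G.IsRightPerron l u)
    (hv : G.IsLeftPerron l v) (hG : G.IsIrreducible) :
    ∃! m, G.IsEquilibriumState (G.edgeFun (-l)) m :=
  ⟨hu.markovState v, (hu.isEquilibriumState_iff hv hG).2 rfl,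
    fun _ hm => (hu.isEquilibriumState_iff hv hG).1 hm⟩

theorem IsRightPerron.state_eq (hu : G.IsRightPerron l u) (hv : G.IsLeftPerron l v)
    (hG : G.IsIrreducible) : G.state l = hu.markovState v := by
  have hex := (hu.existsUnique_isEquilibriumState hv hG).exists
  rw [state, equilibriumState, dif_pos hex]
  exact (hu.isEquilibriumState_iff hv hG).1 hex.choose_spec

theorem IsRightPerron.integral_state (hu : G.IsRightPerron l u) (hv : G.IsLeftPerron l v)
    (hG : G.IsIrreducible) (g : DirEdge k → ℝ) :
    ∫ x, g (x.1 0) ∂(G.state l) = (∑ e, u e * v e * g e) / ∑ e, u e * v e := by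
  have hsum : (∑ f, u f) ≠ 0 := (Finset.sum_pos (fun f _ => hu.pos f) Finset.univ_nonempty).ne'
  have hint : ∀ g : DirEdge k → ℝ,
      ∫ x, g (x.1 0) ∂(markovMeasure hu.initialLaw hu.transitionLaw) =
        (∑ e, u e * g e) / ∑ f, u f := fun g => by
    rw [integral_comp_coord_zero]
    simp only [hu.real_cylinder_one hG hu.dualTransfer_markovMeasure, div_mul_eq_mul_div,
      Finset.sum_div]
  rw [hu.state_eq hv hG, markovState, (hu.isRPF hv).integral_normalizedDensity,
    hint fun e => v e * g e, hint v, div_div_div_cancel_right₀ hsum]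
  simp only [mul_assoc]

theorem IsRightPerron.tendsto_varianceSeq_state (hu : G.IsRightPerron l u)
    (hv : G.IsLeftPerron l v) (hG : G.IsIrreducible) {φ : Fin k → ℝ} {c : ℝ}
    (hφ : G.IsTangent l φ) (hc : |c| < 1)
    (heig : ∀ f, ∑ e ∈ G.predecessors f, Real.exp (-l e.1) * (v e * φ e.1) = c * (v f * φ f.1)) :
    Tendsto (G.varianceSeq (G.edgeFun φ) (G.state l)) atTop
      (𝓝 ((∫ x, G.edgeFun φ x ^ 2 ∂(G.state l)) * ((1 + c) / (1 - c)))) := by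
  have hrpf := hu.isRPF hv
  have : IsProbabilityMeasure (hu.markovState v) := hrpf.isProbabilityMeasure_normalizedDensity
  have hcont : Continuous (G.edgeFun φ) := continuous_comp_coord_zero fun e => φ e.1
  have hseq : G.varianceSeq (G.edgeFun φ) (G.state l) = fun n : ℕ =>
      1 / (n : ℝ) * ∫ x, birkhoffSum G.shift (G.edgeFun φ) n x ^ 2 ∂(G.state l) := by
    funext n
    rw [varianceSeq, show ∫ x, G.edgeFun φ x ∂(G.state l) = 0 from hφ]
    simp only [mul_zero, sub_zero]
  rw [hseq, hu.state_eq hv hG]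
  refine tendsto_integral_birkhoffSum_sq continuous_shift hcont
    (fun w hw => hrpf.integral_comp_shift hw)
    (fun w hw => hrpf.integral_mul_comp_shift hcont (fun x => ?_) hw) hc
  simp only [edgeFun, ← heig]
  exact transfer_comp_coord_zero l (fun e => v e * φ e.1) x

end PerronState

end UGraph

/-! ### The figure-8 graph -/

theorem figureEight_adm {e f : DirEdge 2} : figureEight.Adm e f ↔ f ≠ e.bar := by
  simp [UGraph.Adm, UGraph.origin, UGraph.terminus, figureEight]

theorem figureEight_isIrreducible : figureEight.IsIrreducible := by
  have htwoStep : ∀ e f : DirEdge 2, ∃ g : DirEdge 2, g ≠ e.bar ∧ f ≠ g.bar := by decide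
  intro e f
  obtain ⟨g, heg, hgf⟩ := htwoStep e f
  exact .tail (.single (figureEight_adm.2 heg)) (figureEight_adm.2 hgf)

theorem sum_successors_figureEight (g : Fin 2 → ℝ) (e : DirEdge 2) :
    ∑ f ∈ figureEight.successors e, g f.1 = g 0 + g 1 + g (1 - e.1) := by
  simp only [UGraph.successors, figureEight_adm]
  obtain ⟨i, b⟩ := e
  fin_cases i <;> cases b <;>
    simp [Finset.sum_filter, Fintype.sum_prod_type, DirEdge.bar] <;> ring

theorem sum_predecessors_figureEight (g : Fin 2 → ℝ) (f : DirEdge 2) :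
    ∑ e ∈ figureEight.predecessors f, g e.1 = g 0 + g 1 + g (1 - f.1) := by
  simp only [UGraph.predecessors, figureEight_adm]
  obtain ⟨i, b⟩ := f
  fin_cases i <;> cases b <;>
    simp [Finset.sum_filter, Fintype.sum_prod_type, DirEdge.bar] <;> ring

/-- The edge weightings for which the weighted transition matrix of the figure-8 graph has
spectral radius one. With `a = exp (-l 0)` and `b = exp (-l 1)`, a symmetric eigenvector
`(u₀, u₁)` satisfies `(1 - a) u₀ = 2 a u₁` and `(1 - b) u₁ = 2 b u₀`. -/
structure IsBalanced (l : Fin 2 → ℝ) : Prop where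
  pos : ∀ i, 0 < l i
  eq : (1 - Real.exp (-l 0)) * (1 - Real.exp (-l 1)) = 4 * Real.exp (-l 0) * Real.exp (-l 1)

/-- The right Perron vector of a balanced weighting. -/
def rightWeight (l : Fin 2 → ℝ) : Fin 2 → ℝ := ![2 * Real.exp (-l 0), 1 - Real.exp (-l 0)]

/-- The left Perron vector of a balanced weighting. -/
def leftWeight (l : Fin 2 → ℝ) : Fin 2 → ℝ := ![2 * Real.exp (-l 1), 1 - Real.exp (-l 0)]

theorem exp_neg_lt_one {x : ℝ} (hx : 0 < x) : Real.exp (-x) < 1 :=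
  Real.exp_lt_one_iff.2 (neg_lt_zero.2 hx)

namespace IsBalanced

variable {l φ : Fin 2 → ℝ}

theorem exp_lt_one (h : IsBalanced l) (i : Fin 2) : Real.exp (-l i) < 1 :=
  exp_neg_lt_one (h.pos i)

theorem isRightPerron (h : IsBalanced l) :
    figureEight.IsRightPerron l fun e => rightWeight l e.1 where
  pos e := by
    have h₀ := h.exp_lt_one 0
    have hpos := Real.exp_pos (-l 0)
    generalize e.1 = i
    fin_cases i <;> simp [rightWeight] at * <;> linarith
  eigen e := by
    have heq := h.eq
    rw [sum_successors_figureEight]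
    generalize e.1 = i
    fin_cases i <;> simp [rightWeight] <;> linarith

theorem isLeftPerron (h : IsBalanced l) :
    figureEight.IsLeftPerron l fun e => leftWeight l e.1 where
  pos e := by
    have h₀ := h.exp_lt_one 0
    have hpos := Real.exp_pos (-l 1)
    generalize e.1 = i
    fin_cases i <;> simp [leftWeight] at * <;> linarith
  eigen f := by
    have heq := h.eq
    rw [sum_predecessors_figureEight fun i => Real.exp (-l i) * leftWeight l i]
    generalize f.1 = i
    fin_cases i <;> simp [leftWeight] <;> linarith

theorem hasEntropy_one (h : IsBalanced l) : figureEight.HasEntropy l 1 :=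
  h.isRightPerron.hasEntropy_one figureEight_isIrreducible h.pos

theorem existsUnique_isEquilibriumState (h : IsBalanced l) :
    ∃! m, figureEight.IsEquilibriumState (figureEight.edgeFun (-l)) m :=
  h.isRightPerron.existsUnique_isEquilibriumState h.isLeftPerron figureEight_isIrreducible

theorem integral_edgeFun (h : IsBalanced l) (φ : Fin 2 → ℝ) :
    ∫ x, figureEight.edgeFun φ x ∂(figureEight.state l) =
      ((1 - Real.exp (-l 1)) * φ 0 + (1 - Real.exp (-l 0)) * φ 1) /
        (2 - Real.exp (-l 0) - Real.exp (-l 1)) := by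
  have hint := h.isRightPerron.integral_state h.isLeftPerron figureEight_isIrreducible
    fun e => φ e.1
  have heq := h.eq
  have h₀ := h.exp_lt_one 0
  have h₁ := h.exp_lt_one 1
  simp only [Fintype.sum_prod_type, Fin.sum_univ_two, Fintype.sum_bool, rightWeight, leftWeight,
    Matrix.cons_val_zero, Matrix.cons_val_one, Matrix.cons_val_fin_one] at hint
  refine hint.trans ?_
  generalize Real.exp (-l 0) = a at *
  generalize Real.exp (-l 1) = b at *
  have hnum : ∀ s t : ℝ, 2 * a * (2 * b) * s + 2 * a * (2 * b) * s +
      ((1 - a) * (1 - a) * t + (1 - a) * (1 - a) * t) =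
        2 * (1 - a) * ((1 - b) * s + (1 - a) * t) := fun s t => by
    linear_combination (-2 * s) * heq
  have hden := hnum 1 1
  simp only [mul_one] at hden
  rw [hnum, hden, mul_div_mul_left _ _ (by linarith)]
  congr 1
  ring

theorem isTangent_iff (h : IsBalanced l) :
    figureEight.IsTangent l φ ↔
      (1 - Real.exp (-l 1)) * φ 0 + (1 - Real.exp (-l 0)) * φ 1 = 0 := by
  have h₀ := h.exp_lt_one 0
  have h₁ := h.exp_lt_one 1
  rw [UGraph.IsTangent, h.integral_edgeFun, div_eq_zero_iff, or_iff_left (by linarith)]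

theorem integral_edgeFun_sq (h : IsBalanced l) (hφ : figureEight.IsTangent l φ) :
    ∫ x, figureEight.edgeFun φ x ^ 2 ∂(figureEight.state l) =
      φ 0 ^ 2 * ((1 - Real.exp (-l 1)) / (1 - Real.exp (-l 0))) := by
  have h₀ := h.exp_lt_one 0
  have h₁ := h.exp_lt_one 1
  have htangent := h.isTangent_iff.1 hφ
  refine (h.integral_edgeFun (φ ^ 2)).trans ?_
  rw [← mul_div_assoc, div_eq_div_iff (by linarith) (by linarith)]
  simp only [Pi.pow_apply]
  linear_combination
    ((1 - Real.exp (-l 0)) * φ 1 - (1 - Real.exp (-l 1)) * φ 0) * htangent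

/-- The tangent functions are the second eigenspace of the normalised transfer operator on the
functions of an undirected edge; its eigenvalue is `exp (-l 0) + exp (-l 1) - 1`. -/
theorem sum_predecessors_leftWeight_mul (h : IsBalanced l) (hφ : figureEight.IsTangent l φ)
    (f : DirEdge 2) :
    ∑ e ∈ figureEight.predecessors f, Real.exp (-l e.1) * (leftWeight l e.1 * φ e.1) =
      (Real.exp (-l 0) + Real.exp (-l 1) - 1) * (leftWeight l f.1 * φ f.1) := by
  have heq := h.eq
  have htangent := h.isTangent_iff.1 hφ
  rw [sum_predecessors_figureEight fun i => Real.exp (-l i) * (leftWeight l i * φ i)]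
  generalize f.1 = i
  fin_cases i <;> simp [leftWeight]
  · linear_combination (2 * Real.exp (-l 1)) * htangent
  · linear_combination (1 - Real.exp (-l 0)) * htangent - φ 0 * heq

theorem tendsto_varianceSeq (h : IsBalanced l) (hφ : figureEight.IsTangent l φ) :
    Tendsto (figureEight.varianceSeq (figureEight.edgeFun φ) (figureEight.state l)) atTop
      (𝓝 (φ 0 ^ 2 * ((1 - Real.exp (-l 1)) / (1 - Real.exp (-l 0)) *
        ((Real.exp (-l 0) + Real.exp (-l 1)) / (2 - Real.exp (-l 0) - Real.exp (-l 1)))))) := by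
  have h₀ := h.exp_lt_one 0
  have h₁ := h.exp_lt_one 1
  have hpos₀ := Real.exp_pos (-l 0)
  have hpos₁ := Real.exp_pos (-l 1)
  have hlim := h.isRightPerron.tendsto_varianceSeq_state h.isLeftPerron figureEight_isIrreducible
    hφ (abs_lt.2 ⟨by linarith, by linarith⟩) (h.sum_predecessors_leftWeight_mul hφ)
  rw [h.integral_edgeFun_sq hφ, mul_assoc] at hlim
  convert hlim using 5 <;> ring

theorem pressureNorm_sq (h : IsBalanced l) (hφ : figureEight.IsTangent l φ) :
    figureEight.pressureNorm l φ ^ 2 = φ 0 ^ 2 *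
      ((1 - Real.exp (-l 1)) / (1 - Real.exp (-l 0)) *
        ((Real.exp (-l 0) + Real.exp (-l 1)) / (2 - Real.exp (-l 0) - Real.exp (-l 1)))) := by
  have h₀ : 0 < 1 - Real.exp (-l 0) := sub_pos.2 (h.exp_lt_one 0)
  have h₁ : 0 < 1 - Real.exp (-l 1) := sub_pos.2 (h.exp_lt_one 1)
  have hsum : 0 < 2 - Real.exp (-l 0) - Real.exp (-l 1) := by linarith
  rw [UGraph.pressureNorm, UGraph.dynVariance, (h.tendsto_varianceSeq hφ).limUnder_eq,
    Real.sq_sqrt (by positivity)]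

theorem isTangent_smul (h : IsBalanced l) (hφ : figureEight.IsTangent l φ) (s : ℝ) :
    figureEight.IsTangent l (s • φ) := by
  rw [h.isTangent_iff] at hφ ⊢
  simp only [Pi.smul_apply, smul_eq_mul]
  linear_combination s * hφ

theorem pressureNorm_smul (h : IsBalanced l) (hφ : figureEight.IsTangent l φ) (s : ℝ) :
    figureEight.pressureNorm l (s • φ) = |s| * figureEight.pressureNorm l φ := by
  have hnonneg : ∀ ψ, 0 ≤ figureEight.pressureNorm l ψ := fun _ => Real.sqrt_nonneg _
  rw [← sq_eq_sq₀ (hnonneg _) (mul_nonneg (abs_nonneg s) (hnonneg _)), mul_pow, sq_abs,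
    h.pressureNorm_sq hφ, h.pressureNorm_sq (h.isTangent_smul hφ s), Pi.smul_apply, smul_eq_mul]
  ring

theorem exists_smul (hl : ∀ i, 0 < l i) : ∃ s : ℝ, 0 < s ∧ IsBalanced (s • l) := by
  set f : ℝ → ℝ := fun s => (1 - Real.exp (-(s * l 0))) * (1 - Real.exp (-(s * l 1))) -
    4 * Real.exp (-(s * l 0)) * Real.exp (-(s * l 1)) with hf
  have hexp : ∀ i, Tendsto (fun s : ℝ => Real.exp (-(s * l i))) atTop (𝓝 0) := fun i =>
    Real.tendsto_exp_neg_atTop_nhds_zero.comp (tendsto_id.atTop_mul_const (hl i))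
  have hlim : Tendsto f atTop (𝓝 1) := by
    simpa using (((hexp 0).const_sub 1).mul ((hexp 1).const_sub 1)).sub
      (((hexp 0).const_mul 4).mul (hexp 1))
  obtain ⟨S, hS, hSpos⟩ := ((hlim.eventually_const_lt zero_lt_one).and
    (eventually_gt_atTop (0 : ℝ))).exists
  have hcont : ContinuousOn f (Icc 0 S) := by fun_prop
  obtain ⟨s, hs, hroot⟩ := intermediate_value_Ioo hSpos.le hcont ⟨by simp [hf], hS⟩
  refine ⟨s, hs.1, fun i => mul_pos hs.1 (hl i), ?_⟩
  simpa [hf, sub_eq_zero] using hroot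

end IsBalanced

theorem mem_entropyOne_figureEight_iff {l : Fin 2 → ℝ} :
    l ∈ figureEight.entropyOne ↔ IsBalanced l := by
  refine ⟨fun ⟨hl, hentropy⟩ => ?_, fun h => ⟨h.pos, h.hasEntropy_one⟩⟩
  obtain ⟨s, hs, hbalanced⟩ := IsBalanced.exists_smul hl
  have hs₁ : s * 1 = 1 :=
    tendsto_nhds_unique (UGraph.HasEntropy.of_smul hs hbalanced.hasEntropy_one) hentropy
  simpa [mul_one s ▸ hs₁] using hbalanced

/-! ### The curve of entropy-one weightings -/

theorem exp_neg_eightCurve_one {x : ℝ} (hx : 0 < x) :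
    Real.exp (-eightCurve x 1) = (1 - Real.exp (-x)) / (1 + 3 * Real.exp (-x)) := by
  have hlt := exp_neg_lt_one hx
  simp only [eightCurve, Matrix.cons_val_one, Matrix.cons_val_fin_one, neg_neg]
  exact Real.exp_log (div_pos (by linarith) (by positivity))

theorem isBalanced_eightCurve {x : ℝ} (hx : 0 < x) : IsBalanced (eightCurve x) := by
  have hpos := Real.exp_pos (-x)
  have hexp := exp_neg_eightCurve_one hx
  refine ⟨Fin.forall_fin_two.2 ⟨hx, ?_⟩, ?_⟩
  · rw [← neg_lt_zero, ← Real.exp_lt_one_iff, hexp, div_lt_one (by positivity)]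
    linarith
  · rw [hexp, show eightCurve x 0 = x from rfl]
    field_simp
    ring

theorem IsBalanced.eq_eightCurve {l : Fin 2 → ℝ} (h : IsBalanced l) : l = eightCurve (l 0) := by
  have hexp : Real.exp (-l 1) = (1 - Real.exp (-l 0)) / (1 + 3 * Real.exp (-l 0)) := by
    rw [eq_div_iff (by positivity)]
    linarith [h.eq]
  ext i
  fin_cases i
  · rfl
  · simp [eightCurve, ← hexp]

theorem entropyOne_figureEight : figureEight.entropyOne = eightCurve '' Ioi 0 := by
  ext l
  rw [mem_entropyOne_figureEight_iff]
  constructor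
  · intro h
    exact ⟨l 0, h.pos 0, h.eq_eightCurve.symm⟩
  · rintro ⟨x, hx, rfl⟩
    exact isBalanced_eightCurve hx

theorem contDiffOn_eightCurve : ContDiffOn ℝ ∞ eightCurve (Ioi 0) := by
  rw [contDiffOn_pi, Fin.forall_fin_two]
  refine ⟨contDiffOn_id, ContDiffOn.neg (ContDiffOn.log (ContDiffOn.div (by fun_prop) (by fun_prop)
    fun x _ => by positivity) fun x hx => (div_pos ?_ (by positivity)).ne')⟩
  exact sub_pos.2 (exp_neg_lt_one hx)

theorem hasDerivAt_eightCurve {x : ℝ} (hx : 0 < x) :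
    HasDerivAt eightCurve
      ![1, -(4 * Real.exp (-x) / ((1 - Real.exp (-x)) * (1 + 3 * Real.exp (-x))))] x := by
  have hnum : 1 - Real.exp (-x) ≠ 0 := (sub_pos.2 (exp_neg_lt_one hx)).ne'
  have hden : 1 + 3 * Real.exp (-x) ≠ 0 := by positivity
  have hexp : HasDerivAt (fun y : ℝ => Real.exp (-y)) (-Real.exp (-x)) x := by
    simpa using (hasDerivAt_neg x).exp
  rw [hasDerivAt_pi, Fin.forall_fin_two]
  refine ⟨hasDerivAt_id x, ((((hexp.const_sub 1).div ((hexp.const_mul 3).const_add 1) hden).log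
    (div_ne_zero hnum hden)).neg).congr_deriv ?_⟩
  simp only [Matrix.cons_val_one, Matrix.cons_val_fin_one, Pi.div_apply]
  field_simp
  ring

theorem isTangent_deriv_eightCurve {x : ℝ} (hx : 0 < x) :
    figureEight.IsTangent (eightCurve x) (deriv eightCurve x) := by
  have hnum : 1 - Real.exp (-x) ≠ 0 := (sub_pos.2 (exp_neg_lt_one hx)).ne'
  rw [(isBalanced_eightCurve hx).isTangent_iff, exp_neg_eightCurve_one hx,
    (hasDerivAt_eightCurve hx).deriv]
  simp only [eightCurve, Matrix.cons_val_zero, Matrix.cons_val_one, Matrix.cons_val_fin_one]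
  field_simp
  ring

/-! ### The speed of the curve -/

/-- The square of the pressure norm of the velocity of `eightCurve`. -/
def eightSpeedSq (x : ℝ) : ℝ :=
  4 * Real.exp x * (Real.exp (2 * x) + 3) /
    (Real.exp (4 * x) + 8 * Real.exp (3 * x) + 6 * Real.exp (2 * x) - 24 * Real.exp x + 9)

/-- The pressure norm of the velocity of `eightCurve`. -/
def eightSpeed (x : ℝ) : ℝ := √(eightSpeedSq x)

theorem eightSpeedSq_eq (x : ℝ) : eightSpeedSq x =
    4 * Real.exp x * (Real.exp x ^ 2 + 3) /
      ((Real.exp x ^ 2 + 6 * Real.exp x - 3) * (Real.exp x + 3)) / (Real.exp x - 1) := by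
  have hpow : ∀ n : ℕ, Real.exp (n * x) = Real.exp x ^ n := Real.exp_nat_mul x
  have h₂ := hpow 2
  have h₃ := hpow 3
  have h₄ := hpow 4
  push_cast at h₂ h₃ h₄
  rw [eightSpeedSq, h₂, h₃, h₄, div_div]
  congr 1
  ring

theorem eightSpeedSq_pos {x : ℝ} (hx : 0 < x) : 0 < eightSpeedSq x := by
  have hexp : 1 < Real.exp x := Real.one_lt_exp_iff.2 hx
  have hquad : 0 < Real.exp x ^ 2 + 6 * Real.exp x - 3 := by nlinarith
  rw [eightSpeedSq_eq]
  positivity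

theorem eightSpeed_pos {x : ℝ} (hx : 0 < x) : 0 < eightSpeed x :=
  Real.sqrt_pos.2 (eightSpeedSq_pos hx)

theorem pressureNorm_deriv_eightCurve_sq {x : ℝ} (hx : 0 < x) :
    figureEight.pressureNorm (eightCurve x) (deriv eightCurve x) ^ 2 = eightSpeedSq x := by
  have hexp : 1 < Real.exp x := Real.one_lt_exp_iff.2 hx
  rw [(isBalanced_eightCurve hx).pressureNorm_sq (isTangent_deriv_eightCurve hx),
    exp_neg_eightCurve_one hx, (hasDerivAt_eightCurve hx).deriv, eightSpeedSq_eq]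
  simp only [eightCurve, Matrix.cons_val_zero, Real.exp_neg, one_pow, one_mul]
  generalize Real.exp x = E at *
  have hb : (1 - E⁻¹) / (1 + 3 * E⁻¹) = (E - 1) / (E + 3) := by field_simp
  have hone_sub_b : 1 - (E - 1) / (E + 3) = 4 / (E + 3) := by field_simp; ring
  have hadd : E⁻¹ + (E - 1) / (E + 3) = (E ^ 2 + 3) / (E * (E + 3)) := by field_simp; ring
  have hsub : 2 - E⁻¹ - (E - 1) / (E + 3) = (E ^ 2 + 6 * E - 3) / (E * (E + 3)) := by
    field_simp
    ring
  have hone_sub_a : 1 - E⁻¹ = (E - 1) / E := by field_simp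
  have hlin : E - 1 ≠ 0 := by linarith
  rw [hb, hone_sub_b, hadd, hsub, hone_sub_a]
  field_simp

theorem pressureNorm_deriv_eightCurve {x : ℝ} (hx : 0 < x) :
    figureEight.pressureNorm (eightCurve x) (deriv eightCurve x) = eightSpeed x := by
  rw [eightSpeed, ← pressureNorm_deriv_eightCurve_sq hx]
  exact (Real.sqrt_sq (Real.sqrt_nonneg _)).symm

theorem isEquivalent_eightSpeedSq :
    Asymptotics.IsEquivalent (𝓝[>] (0 : ℝ)) eightSpeedSq fun x => 1 / x := by
  have hslope : Tendsto (fun x : ℝ => (x⁻¹ * (Real.exp x - 1))⁻¹) (𝓝[>] 0) (𝓝 1) := by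
    have hderiv := (Real.hasDerivAt_exp 0).tendsto_slope_zero_right.inv₀ (Real.exp_ne_zero 0)
    simpa using hderiv
  have hregular : Tendsto (fun x : ℝ => 4 * Real.exp x * (Real.exp x ^ 2 + 3) /
      ((Real.exp x ^ 2 + 6 * Real.exp x - 3) * (Real.exp x + 3))) (𝓝[>] 0) (𝓝 1) := by
    have hcont : ContinuousAt (fun x : ℝ => 4 * Real.exp x * (Real.exp x ^ 2 + 3) /
        ((Real.exp x ^ 2 + 6 * Real.exp x - 3) * (Real.exp x + 3))) 0 :=
      ContinuousAt.div (by fun_prop) (by fun_prop) (by norm_num)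
    convert hcont.tendsto.mono_left nhdsWithin_le_nhds using 2
    norm_num
  refine (Asymptotics.isEquivalent_iff_tendsto_one ?_).2 ?_
  · filter_upwards [self_mem_nhdsWithin] with x hx
    exact one_div_ne_zero (ne_of_gt hx)
  · refine (one_mul (1 : ℝ) ▸ hregular.mul hslope).congr fun x => ?_
    rw [Pi.div_apply, eightSpeedSq_eq]
    simp only [mul_inv, inv_inv, one_div, div_inv_eq_mul]
    ring

theorem continuousOn_eightSpeed : ContinuousOn eightSpeed (Ioi 0) := by
  refine ContinuousOn.sqrt (ContinuousOn.div (by fun_prop) (by fun_prop) fun x hx hzero => ?_)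
  have hpos := eightSpeedSq_pos hx
  rw [eightSpeedSq, hzero, div_zero] at hpos
  exact hpos.false

theorem measurable_eightSpeed : Measurable eightSpeed := by
  unfold eightSpeed eightSpeedSq
  fun_prop

theorem eightSpeedSq_le {x : ℝ} (hx : 0 < x) : eightSpeedSq x ≤ 4 / x := by
  have hexp : x + 1 ≤ Real.exp x := Real.add_one_le_exp x
  rw [eightSpeedSq_eq]
  generalize Real.exp x = E at *
  have hquad : 0 < E ^ 2 + 6 * E - 3 := by nlinarith
  have hlin : 0 < E + 3 := by linarith
  have hregular : 4 * E * (E ^ 2 + 3) / ((E ^ 2 + 6 * E - 3) * (E + 3)) ≤ 4 := by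
    rw [div_le_iff₀ (by positivity)]
    nlinarith
  gcongr
  linarith

theorem eightSpeed_le {x : ℝ} (hx : 0 < x) : eightSpeed x ≤ 2 * x ^ (-(1 / 2) : ℝ) :=
  calc eightSpeed x ≤ √(4 / x) := Real.sqrt_le_sqrt (eightSpeedSq_le hx)
    _ = √(2 ^ 2 / x) := by norm_num
    _ = 2 * x ^ (-(1 / 2) : ℝ) := by
      rw [Real.sqrt_div (by positivity), Real.sqrt_sq zero_le_two, Real.rpow_neg hx.le,
        ← Real.sqrt_eq_rpow, div_eq_mul_inv]

theorem intervalIntegrable_eightSpeed {x : ℝ} (hx : 0 < x) :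
    IntervalIntegrable eightSpeed volume 0 x := by
  have hbound : IntervalIntegrable (fun y : ℝ => 2 * y ^ (-(1 / 2) : ℝ)) volume 0 x :=
    (intervalIntegral.intervalIntegrable_rpow' (by norm_num)).const_mul 2
  refine hbound.mono_fun measurable_eightSpeed.aestronglyMeasurable ?_
  filter_upwards [ae_restrict_mem measurableSet_uIoc] with y hy
  rw [uIoc_of_le hx.le] at hy
  rw [Real.norm_of_nonneg (eightSpeed_pos hy.1).le]
  exact (eightSpeed_le hy.1).trans (le_abs_self _)

theorem lintegral_pressureNorm_deriv_eightCurve_lt_top :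
    (∫⁻ x in Ioc (0 : ℝ) 1,
      ENNReal.ofReal (figureEight.pressureNorm (eightCurve x) (deriv eightCurve x))) < ⊤ := by
  rw [setLIntegral_congr_fun measurableSet_Ioc fun x hx => by
    rw [pressureNorm_deriv_eightCurve hx.1]]
  exact ((intervalIntegrable_iff_integrableOn_Ioc_of_le zero_le_one).1
    (intervalIntegrable_eightSpeed one_pos)).lintegral_lt_top

/-! ### The path distance -/

/-- The pressure length of the arc of `eightCurve` over `(0, x]`. -/
def arcLength (x : ℝ) : ℝ := ∫ t in (0 : ℝ)..x, eightSpeed t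

theorem hasDerivAt_arcLength {x : ℝ} (hx : 0 < x) : HasDerivAt arcLength (eightSpeed x) x :=
  intervalIntegral.integral_hasDerivAt_right (intervalIntegrable_eightSpeed hx)
    measurable_eightSpeed.stronglyMeasurable.stronglyMeasurableAtFilter
    (continuousOn_eightSpeed.continuousAt (Ioi_mem_nhds hx))

theorem contDiffOn_arcLength : ContDiffOn ℝ 1 arcLength (Ioi 0) := by
  have hderiv : ∀ x ∈ Ioi (0 : ℝ), HasDerivWithinAt arcLength (eightSpeed x) (Ioi 0) x :=
    fun x hx => (hasDerivAt_arcLength hx).hasDerivWithinAt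
  refine (contDiffOn_one_iff_derivWithin (uniqueDiffOn_Ioi 0)).2
    ⟨fun x hx => (hderiv x hx).differentiableWithinAt, continuousOn_eightSpeed.congr fun x hx =>
      (hderiv x hx).derivWithin (uniqueDiffOn_Ioi 0 x hx)⟩

theorem arcLength_pos {x : ℝ} (hx : 0 < x) : 0 < arcLength x :=
  intervalIntegral.intervalIntegral_pos_of_pos_on (intervalIntegrable_eightSpeed hx)
    (fun _ hy => eightSpeed_pos hy.1) hx

theorem strictMonoOn_arcLength : StrictMonoOn arcLength (Ioi 0) := by
  refine strictMonoOn_of_deriv_pos (convex_Ioi 0) contDiffOn_arcLength.continuousOn fun x hx => ?_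
  rw [interior_Ioi] at hx
  exact (hasDerivAt_arcLength hx).deriv ▸ eightSpeed_pos hx

theorem tendsto_arcLength_nhdsGT_zero : Tendsto arcLength (𝓝[>] 0) (𝓝 0) := by
  have hcont : ContinuousWithinAt arcLength (Icc 0 1) 0 := by
    rw [← uIcc_of_le zero_le_one]
    exact intervalIntegral.continuousOn_primitive_interval'
      (intervalIntegrable_eightSpeed one_pos) left_mem_uIcc 0 left_mem_uIcc
  have hzero : arcLength 0 = 0 := intervalIntegral.integral_same
  rw [ContinuousWithinAt, hzero] at hcont
  rw [← nhdsWithin_Ioo_eq_nhdsGT (zero_lt_one' ℝ)]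
  exact hcont.mono_left (nhdsWithin_mono _ Ioo_subset_Icc_self)

theorem lintegral_enorm_derivWithin_of_monotoneOn {f : ℝ → ℝ} {a b : ℝ} (hab : a ≤ b)
    (hf : ContDiffOn ℝ 1 f (Icc a b)) (hmono : MonotoneOn f (Icc a b)) :
    ∫⁻ t in Icc a b, ‖derivWithin f (Icc a b) t‖ₑ = ‖f b - f a‖ₑ := by
  rcases hab.eq_or_lt with rfl | hlt
  · simp
  have hint : IntegrableOn (derivWithin f (Icc a b)) (Icc a b) :=
    (hf.continuousOn_derivWithin (uniqueDiffOn_Icc hlt) le_rfl).integrableOn_Icc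
  have hnonneg : ∀ t, 0 ≤ derivWithin f (Icc a b) t := fun t => hmono.derivWithin_nonneg
  simp_rw [Real.enorm_of_nonneg (hnonneg _)]
  rw [← ofReal_integral_eq_lintegral_ofReal hint (ae_of_all _ hnonneg),
    integral_Icc_eq_integral_Ioc, ← intervalIntegral.integral_of_le hab,
    intervalIntegral.integral_derivWithin_Icc_of_contDiffOn_Icc hf hab,
    Real.enorm_of_nonneg (sub_nonneg.2 (hmono (left_mem_Icc.2 hab) (right_mem_Icc.2 hab) hab))]

theorem lintegral_enorm_derivWithin_of_antitoneOn {f : ℝ → ℝ} {a b : ℝ} (hab : a ≤ b)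
    (hf : ContDiffOn ℝ 1 f (Icc a b)) (hanti : AntitoneOn f (Icc a b)) :
    ∫⁻ t in Icc a b, ‖derivWithin f (Icc a b) t‖ₑ = ‖f b - f a‖ₑ := by
  simpa [derivWithin.fun_neg, enorm_sub_rev, neg_add_eq_sub] using
    lintegral_enorm_derivWithin_of_monotoneOn hab hf.neg hanti.neg

section Curve

variable {p q : Fin 2 → ℝ} {γ : ℝ → Fin 2 → ℝ}

theorem contDiffOn_arcLength_comp (hγ : figureEight.IsCurve p q γ) :
    ContDiffOn ℝ 1 (fun t => arcLength (γ t 0)) (Icc 0 1) :=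
  contDiffOn_arcLength.comp (contDiffOn_pi.1 hγ.contDiffOn 0) fun t ht => (hγ.mem t ht).1 0

theorem pressureNorm_derivWithin (hγ : figureEight.IsCurve p q γ) {t : ℝ}
    (ht : t ∈ Icc (0 : ℝ) 1) :
    figureEight.pressureNorm (γ t) (derivWithin γ (Icc 0 1) t) =
      |derivWithin (fun s => arcLength (γ s 0)) (Icc 0 1) t| := by
  have hpos : 0 < γ t 0 := (hγ.mem t ht).1 0
  have hunique := uniqueDiffOn_Icc (zero_lt_one' ℝ) t ht
  have hcurve : ∀ s ∈ Icc (0 : ℝ) 1, γ s = eightCurve (γ s 0) := fun s hs =>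
    (mem_entropyOne_figureEight_iff.1 (hγ.mem s hs)).eq_eightCurve
  set v := derivWithin (fun s => γ s 0) (Icc 0 1) t
  have hcoord : HasDerivWithinAt (fun s => γ s 0) v (Icc 0 1) t :=
    ((contDiffOn_pi.1 hγ.contDiffOn 0).differentiableOn one_ne_zero t ht).hasDerivWithinAt
  have hvelocity : derivWithin γ (Icc 0 1) t = v • deriv eightCurve (γ t 0) :=
    (((hasDerivAt_eightCurve hpos).differentiableAt.hasDerivAt.scomp_hasDerivWithinAt t
      hcoord).congr hcurve (hcurve t ht)).derivWithin hunique
  have harc : derivWithin (fun s => arcLength (γ s 0)) (Icc 0 1) t = eightSpeed (γ t 0) * v :=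
    (HasDerivAt.comp_hasDerivWithinAt (h₂ := arcLength) t (hasDerivAt_arcLength hpos)
      hcoord).derivWithin hunique
  calc figureEight.pressureNorm (γ t) (derivWithin γ (Icc 0 1) t)
      = figureEight.pressureNorm (eightCurve (γ t 0)) (v • deriv eightCurve (γ t 0)) := by
        rw [hvelocity, ← hcurve t ht]
    _ = |v| * eightSpeed (γ t 0) := by
        rw [(isBalanced_eightCurve hpos).pressureNorm_smul (isTangent_deriv_eightCurve hpos),
          pressureNorm_deriv_eightCurve hpos]
    _ = |derivWithin (fun s => arcLength (γ s 0)) (Icc 0 1) t| := by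
        rw [harc, abs_mul, abs_of_pos (eightSpeed_pos hpos), mul_comm]

theorem pressureLength_eq_lintegral (hγ : figureEight.IsCurve p q γ) :
    figureEight.pressureLength γ =
      ∫⁻ t in Icc (0 : ℝ) 1, ‖derivWithin (fun s => arcLength (γ s 0)) (Icc 0 1) t‖ₑ :=
  setLIntegral_congr_fun measurableSet_Icc fun t ht => by
    rw [pressureNorm_derivWithin hγ ht, Real.enorm_eq_ofReal_abs]

theorem enorm_arcLength_sub_le_pressureLength (hγ : figureEight.IsCurve p q γ) :
    ‖arcLength (q 0) - arcLength (p 0)‖ₑ ≤ figureEight.pressureLength γ := by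
  simpa only [pressureLength_eq_lintegral hγ, hγ.source, hγ.target] using
    enorm_sub_le_lintegral_derivWithin_Icc_of_contDiffOn_Icc
      (contDiffOn_arcLength_comp hγ) zero_le_one

/-- The curve of entropy-one weightings from `p` to `q` whose first coordinate is affine; it
realises the distance from `p` to `q`. -/
def affineCurve (p q : Fin 2 → ℝ) (t : ℝ) : Fin 2 → ℝ :=
  eightCurve (AffineMap.lineMap (p 0) (q 0) t)

theorem isCurve_affineCurve (hp : p ∈ figureEight.entropyOne) (hq : q ∈ figureEight.entropyOne) :
    figureEight.IsCurve p q (affineCurve p q) := by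
  have hpos : MapsTo (AffineMap.lineMap (p 0) (q 0)) (Icc (0 : ℝ) 1) (Ioi 0) := fun t ht =>
    (convex_Ioi 0).lineMap_mem (hp.1 0) (hq.1 0) ht
  refine ⟨(contDiffOn_eightCurve.of_le (mod_cast le_top)).comp
    (AffineMap.contDiff_lineMap _ _).contDiffOn hpos,
    fun t ht => mem_entropyOne_figureEight_iff.2 (isBalanced_eightCurve (hpos ht)), ?_, ?_⟩
  · simpa [affineCurve] using (mem_entropyOne_figureEight_iff.1 hp).eq_eightCurve.symm
  · simpa [affineCurve] using (mem_entropyOne_figureEight_iff.1 hq).eq_eightCurve.symm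

theorem pressureLength_affineCurve (hp : p ∈ figureEight.entropyOne)
    (hq : q ∈ figureEight.entropyOne) :
    figureEight.pressureLength (affineCurve p q) = ‖arcLength (q 0) - arcLength (p 0)‖ₑ := by
  have hγ := isCurve_affineCurve hp hq
  have hpos : MapsTo (AffineMap.lineMap (p 0) (q 0)) (Icc (0 : ℝ) 1) (Ioi 0) := fun t ht =>
    (hγ.mem t ht).1 0
  have harc := contDiffOn_arcLength_comp hγ
  rw [pressureLength_eq_lintegral hγ]
  rcases le_total (p 0) (q 0) with hpq | hqp
  · have hmono := strictMonoOn_arcLength.monotoneOn.comp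
      ((AffineMap.lineMap_mono (k := ℝ) hpq).monotoneOn _) hpos
    simpa only [hγ.source, hγ.target] using
      lintegral_enorm_derivWithin_of_monotoneOn zero_le_one harc hmono
  · have hanti := strictMonoOn_arcLength.monotoneOn.comp_AntitoneOn
      ((AffineMap.lineMap_anti (k := ℝ) hqp).antitoneOn _) hpos
    simpa only [hγ.source, hγ.target] using
      lintegral_enorm_derivWithin_of_antitoneOn zero_le_one harc hanti

end Curve

theorem pressureDist_figureEight (p q : figureEight.entropyOne) :
    figureEight.pressureDist p q = edist (arcLength (p.1 0)) (arcLength (q.1 0)) := by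
  rw [edist_comm, edist_eq_enorm_sub]
  exact le_antisymm
    ((iInf₂_le _ (isCurve_affineCurve p.2 q.2)).trans_eq (pressureLength_affineCurve p.2 q.2))
    (le_iInf₂ fun _ hγ => enorm_arcLength_sub_le_pressureLength hγ)

theorem injective_arcLength_apply_zero :
    Function.Injective fun p : figureEight.entropyOne => arcLength (p.1 0) := by
  intro p q hpq
  have hcoord : p.1 0 = q.1 0 := strictMonoOn_arcLength.injOn (p.2.1 0) (q.2.1 0) hpq
  ext1
  rw [(mem_entropyOne_figureEight_iff.1 p.2).eq_eightCurve,
    (mem_entropyOne_figureEight_iff.1 q.2).eq_eightCurve, hcoord]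

theorem not_isClosed_range_arcLength_apply_zero :
    ¬IsClosed (Set.range fun p : figureEight.entropyOne => arcLength (p.1 0)) := by
  intro hclosed
  have hmem : ∀ᶠ x in 𝓝[>] (0 : ℝ), arcLength x ∈
      Set.range fun p : figureEight.entropyOne => arcLength (p.1 0) := by
    filter_upwards [self_mem_nhdsWithin] with x hx
    exact ⟨⟨eightCurve x, mem_entropyOne_figureEight_iff.2 (isBalanced_eightCurve hx)⟩, rfl⟩
  obtain ⟨p, hp⟩ := hclosed.mem_of_tendsto tendsto_arcLength_nhdsGT_zero hmem
  exact (arcLength_pos (p.2.1 0)).ne' hp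

theorem isIncompleteMetric_of_edist_eq {X : Type} {Y : Type*} [MetricSpace Y] {d : X → X → ℝ≥0∞}
    {f : X → Y} (hf : Function.Injective f) (hd : ∀ p q, d p q = edist (f p) (f q))
    (hrange : ¬IsClosed (Set.range f)) : IsIncompleteMetric d := by
  let : MetricSpace X := MetricSpace.induced f hf inferInstance
  have hiso : Isometry f := Isometry.of_dist_eq fun _ _ => rfl
  exact ⟨this, fun p q => (hiso p q).symm.trans (hd p q).symm,
    fun _ => hrange hiso.isClosedEmbedding.isClosed_range⟩

theorem isIncompleteMetric_pressureDist_figureEight :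
    IsIncompleteMetric figureEight.pressureDist :=
  isIncompleteMetric_of_edist_eq injective_arcLength_apply_zero pressureDist_figureEight
    not_isClosed_range_arcLength_apply_zero

end MetricGraph

end

theorem proposition4p1 :
    -- the pressure metric is well defined on the space of entropy-one weightings
    (∀ l ∈ figureEight.entropyOne,
      (∃! m, figureEight.IsEquilibriumState (figureEight.edgeFun (-l)) m) ∧
      ∀ φ : Fin 2 → ℝ, figureEight.IsTangent l φ →
        ∃ V : ℝ, Tendsto (figureEight.varianceSeq (figureEight.edgeFun φ) (figureEight.state l))
          atTop (𝓝 V)) ∧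
    -- this space is a smooth curve parametrised by the length `x > 0` of the first edge
    figureEight.entropyOne = eightCurve '' Ioi 0 ∧
    ContDiffOn ℝ ∞ eightCurve (Ioi 0) ∧
    -- the pressure norm of the velocity of this curve
    (∀ x : ℝ, 0 < x →
      figureEight.IsTangent (eightCurve x) (deriv eightCurve x) ∧
      figureEight.pressureNorm (eightCurve x) (deriv eightCurve x) ^ 2 =
        4 * Real.exp x * (Real.exp (2 * x) + 3) /
          (Real.exp (4 * x) + 8 * Real.exp (3 * x) + 6 * Real.exp (2 * x)
            - 24 * Real.exp x + 9)) ∧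
    Asymptotics.IsEquivalent (𝓝[>] (0 : ℝ))
      (fun x => figureEight.pressureNorm (eightCurve x) (deriv eightCurve x) ^ 2)
      (fun x => 1 / x) ∧
    -- the end `x → 0` is reached at finite length
    (∫⁻ x in Ioc (0 : ℝ) 1,
      ENNReal.ofReal (figureEight.pressureNorm (eightCurve x) (deriv eightCurve x))) < ⊤ ∧
    -- incompleteness
    IsIncompleteMetric figureEight.pressureDist := by
  have hbalanced : ∀ {l}, l ∈ figureEight.entropyOne → IsBalanced l :=
    mem_entropyOne_figureEight_iff.1
  refine ⟨fun l hl => ⟨(hbalanced hl).existsUnique_isEquilibriumState,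
      fun φ hφ => ⟨_, (hbalanced hl).tendsto_varianceSeq hφ⟩⟩,
    entropyOne_figureEight, contDiffOn_eightCurve,
    fun x hx => ⟨isTangent_deriv_eightCurve hx, pressureNorm_deriv_eightCurve_sq hx⟩,
    isEquivalent_eightSpeedSq.congr_left ?_,
    lintegral_pressureNorm_deriv_eightCurve_lt_top, isIncompleteMetric_pressureDist_figureEight⟩
  filter_upwards [self_mem_nhdsWithin] with x hx
  exact (pressureNorm_deriv_eightCurve_sq hx).symm
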